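/- **Setting.** Let $0<T<\infty$ and let $(\Omega,\mathcal F,\mathbb F=(\mathcal F_t)_{0\le t\le T},\mathbb P)$ be a filtered probability space satisfying the usual conditions. Let $\mathcal T$ be the set of $\mathbb F$-stopping times with values in $[0,T]$, and let $Y=(Y_t)_{0\le t\le T}$ be a real-valued, $\mathbb F$-adapted, right-continuous process. Let $\mathcal S$ be a finite set of scenarios with the discrete topology, $\mathcal M(\mathcal S)$ the set of probability measures on $\mathcal S$ with the topology of weak convergence, and $\mathcal P\in\mathcal M(\mathcal S)$ a reference measure. For each $\theta\in\mathcal S$ let $\mathbb P^\theta$ be a probability measure on $(\Omega,\mathcal F)$, with expectation $\mathbb E^\theta$. For $\mathcal Q\in\mathcal M(\mathcal S)$ let $\mathbb P^{\mathcal Q}$ be the probability measure $\mathbb P^{\mathcal Q}(B)=\int_{\mathcal S}\int_\Omega \mathbf 1_B(\theta,\omega)\,d\mathbb P^\theta(\omega)\,d\mathcal Q(\theta)$ on $\mathcal S\times\Omega$. Let $v:\mathbb R\to[-\infty,\infty)$ be proper (not identically $-\infty$), concave, nondecreasing and upper semicontinuous, and put $v^{-1}(y)=\sup\{x\in\mathbb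 R: v(x)\le y\}\in[-\infty,\infty]$. The Drapeau–Kupper function of $v$ is the unique function $R:\mathcal M(\mathcal S)\times\mathbb R\to[-\infty,\infty]$ such that $$v^{-1}\Big(\int_{\mathcal S} v(X)\,d\mathcal P\Big)=\inf_{\mathcal Q\in\mathcal M(\mathcal S)}R\Big(\mathcal Q,\int_{\mathcal S} X\,d\mathcal Q\Big)\qquad\text{for all } X:\mathcal S\to\mathbb R,$$ (i) $R(\mathcal Q,\cdot)$ is nondecreasing and right-continuous for every $\mathcal Q$; (ii) $R$ is jointly quasi-convex; (iii) $\lim_{s\to\infty}R(\mathcal Q,s)$ does not depend on $\mathcal Q$; (iv) $\mathcal Q\mapsto\sup_{s'<s}R(\mathcal Q,s')$ is lower semicontinuous for every $s$. Explicitly, $R(\mathcal Q,s)=\inf_{s'>s}\sup\{v^{-1}(\int_{\mathcal S} v(X)\,d\mathcal P): X:\mathcal S\to\mathbb R,\ \int_{\mathcal S} X\,d\mathcal Q\le s'\}$. Put $G(\tau,\mathcal Q)=R(\mathcal Q,\mathbb E^{\mathbb P^{\mathcal Q}}[Y_\tau])$. **Theorem.** Assume that 1. $\mathbb P^\theta\ll\mathbb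 P$ for every $\theta\in\mathcal S$; 2. there is a constant $C<\infty$ with $\mathbb E^\theta[\sup_{0\le t\le T}|Y_t|]<C$ for every $\theta\in\mathcal S$; 3. either $R(\mathcal Q,\cdot)$ is continuous on $\mathbb R$ (as an extended-real-valued function) for every $\mathcal Q\in\mathcal M(\mathcal S)$, or $R(\mathcal Q,\cdot)$ is continuous on $(0,\infty)$ for every $\mathcal Q\in\mathcal M(\mathcal S)$ and $\mathbb E^\theta[Y_\tau]>0$ for all $\tau\in\mathcal T$ and $\theta\in\mathcal S$. Let $\mathbb T=\{t_1,\dots,t_r\}$ with $0<t_1<\dots<t_r=T$, $r\ge1$, assume that the probability space $(\Omega,\mathcal F_t,\mathbb P|_{\mathcal F_t})$ is non-atomic for every $t\in\mathbb T$, and let $\mathcal T_{\mathbb T}$ be the set of $\mathbb F$-stopping times with values in $\mathbb T$. Then there exist $\tau^*\in\mathcal T_{\mathbb T}$ and $\mathcal Q^*\in\mathcal M(\mathcal S)$ such that $$G(\tau,\mathcal Q^*)\le G(\tau^*,\mathcal Q^*)\le G(\tau^*,\mathcal Q)\qquad\text{for all }\tau\in\mathcal T_{\mathbb T},\ \mathcal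 Q\in\mathcal M(\mathcal S).$$ In particular $$G(\tau^*,\mathcal Q^*)=\max_{\tau\in\mathcal T_{\mathbb T}}\min_{\mathcal Q\in\mathcal M(\mathcal S)}G(\tau,\mathcal Q)=\min_{\mathcal Q\in\mathcal M(\mathcal S)}\max_{\tau\in\mathcal T_{\mathbb T}}G(\tau,\mathcal Q),$$ where all the inner and outer maxima and minima are attained. -/

import Mathlib

open MeasureTheory ProbabilityTheory Set Filter Topology

namespace AmbiguityStopping

noncomputable section

set_option linter.unusedSectionVars false

variable {S : Type*} [Fintype S] [TopologicalSpace S] [DiscreteTopology S]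
  [MeasurableSpace S] [BorelSpace S]

/-- Proper concave nondecreasing upper semicontinuous functions, with values in `[-∞, ∞)`.
Concavity is convexity of the hypograph. -/
structure IsAmbiguityFunction (v : ℝ → EReal) : Prop where
  ne_top : ∀ x, v x ≠ ⊤
  exists_ne_bot : ∃ x, v x ≠ ⊥
  concave : Convex ℝ {p : ℝ × ℝ | (p.2 : EReal) ≤ v p.1}
  monotone : Monotone v
  usc : UpperSemicontinuous v

/-- The generalized inverse `v⁻¹(y) = sup {x ∈ ℝ : v x ≤ y}`; it is the inverse of `v` on the range
of `v` if `v` is injective, and for `v = -∞` exactly on `(-∞, 0)` it sends `-∞` to `0`. -/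
def genInverse (v : ℝ → EReal) (y : EReal) : EReal :=
  ⨆ x : {x : ℝ // v x ≤ y}, ((x : ℝ) : EReal)

/-- `v⁻¹(∫ v(X) dP₀)` for a function `X` on the finite scenario set. The sum is taken in
`[-∞, ∞)`, with `0 * (-∞) = 0`. -/
def certaintyEquivalent (v : ℝ → EReal) (P₀ : ProbabilityMeasure S) (X : S → ℝ) : EReal :=
  genInverse v (∑ θ, (((P₀ : Measure S).real {θ} : ℝ) : EReal) * v (X θ))

/-- The properties that single out the Drapeau–Kupper function `R` of `v`: the robust representation
of the certainty equivalent, together with the four regularity properties. -/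
structure IsDrapeauKupper (v : ℝ → EReal) (P₀ : ProbabilityMeasure S)
    (R : ProbabilityMeasure S → ℝ → EReal) : Prop where
  representation : ∀ X : S → ℝ, certaintyEquivalent v P₀ X = ⨅ Q, R Q (∫ θ, X θ ∂(Q : Measure S))
  monotone : ∀ Q, Monotone (R Q)
  right_continuous : ∀ Q s, ContinuousWithinAt (R Q) (Ici s) s
  quasiconvex : ∀ (Q₁ Q₂ Q : ProbabilityMeasure S) (a b : NNReal), a + b = 1 →
    (Q : Measure S) = a • (Q₁ : Measure S) + b • (Q₂ : Measure S) →
    ∀ s₁ s₂ : ℝ, R Q (a * s₁ + b * s₂) ≤ max (R Q₁ s₁) (R Q₂ s₂)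
  limit : ∃ l : EReal, ∀ Q, Tendsto (R Q) atTop (𝓝 l)
  lsc : ∀ s : ℝ, LowerSemicontinuous fun Q => ⨆ s' : Iio s, R Q s'

/-- The Drapeau–Kupper function of `v`. That it is the one and only function with the
properties `IsDrapeauKupper v P₀` is `isDrapeauKupper_iff` below. -/
def drapeauKupper (v : ℝ → EReal) (P₀ : ProbabilityMeasure S)
    (Q : ProbabilityMeasure S) (s : ℝ) : EReal :=
  ⨅ s' : Ioi s, ⨆ X : {X : S → ℝ // ∫ θ, X θ ∂(Q : Measure S) ≤ s'}, certaintyEquivalent v P₀ X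

/-! ### The optimal stopping game -/

section Game

variable {Ω : Type*} {mΩ : MeasurableSpace Ω} {T : ℝ}

/-- Completeness (`𝔽 t` contains all `P`-null sets) and right-continuity of a filtration. -/
structure UsualConditions (𝔽 : Filtration (Icc (0 : ℝ) T) mΩ) (P : Measure Ω) : Prop where
  complete : ∀ t (A : Set Ω), P A = 0 → MeasurableSet[𝔽 t] A
  right_continuous : 𝔽.IsRightContinuous

/-- The restriction of `μ` to the sub-σ-algebra `m` has no atoms. -/
def IsNonatomicOn (μ : @Measure Ω mΩ) (m : MeasurableSpace Ω) : Prop :=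
  ∀ A, MeasurableSet[m] A → 0 < μ A → ∃ B ⊆ A, MeasurableSet[m] B ∧ 0 < μ B ∧ μ B < μ A

/-- Stopping times with values in `[0, T]`. -/
def stoppingTimes (𝔽 : Filtration (Icc (0 : ℝ) T) mΩ) : Set (Ω → Icc (0 : ℝ) T) :=
  {τ | IsStoppingTime 𝔽 fun ω => (τ ω : WithTop (Icc (0 : ℝ) T))}

/-- Stopping times with values in the grid `{t 0, …, t n}`. -/
def gridStoppingTimes (𝔽 : Filtration (Icc (0 : ℝ) T) mΩ) {n : ℕ}
    (t : Fin (n + 1) → Icc (0 : ℝ) T) : Set (Ω → Icc (0 : ℝ) T) :=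
  {τ ∈ stoppingTimes 𝔽 | ∀ ω, τ ω ∈ range t}

/-- The measure `P^Q` on `S × Ω`: `P^Q(B) = ∫∫ 1_B(θ, ω) dP^θ(ω) dQ(θ)`. The family `(P^θ)` of
probability measures is given as a Markov kernel; on a finite discrete `S` every family is one. -/
def mixture (κ : Kernel S Ω) (Q : ProbabilityMeasure S) : Measure (S × Ω) :=
  (Q : Measure S) ⊗ₘ κ

/-- The payoff `G(τ, Q) = R(Q, E^{P^Q}[Y_τ])` with `R` the Drapeau–Kupper function of `v`. -/
def payoff (v : ℝ → EReal) (P₀ : ProbabilityMeasure S) (κ : Kernel S Ω)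
    (Y : Icc (0 : ℝ) T → Ω → ℝ) (τ : Ω → Icc (0 : ℝ) T) (Q : ProbabilityMeasure S) : EReal :=
  drapeauKupper v P₀ Q (∫ x, Y (τ x.2) x.2 ∂(mixture κ Q))

/-- Continuity of `R` in the second argument on `ℝ`, or on `(0, ∞)` if all `E^θ[Y_τ]` are
positive. -/
def ContinuityCondition (v : ℝ → EReal) (P₀ : ProbabilityMeasure S) (κ : Kernel S Ω)
    (𝔽 : Filtration (Icc (0 : ℝ) T) mΩ) (Y : Icc (0 : ℝ) T → Ω → ℝ) : Prop :=
  (∀ Q, Continuous (drapeauKupper v P₀ Q)) ∨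
    ((∀ Q, ContinuousOn (drapeauKupper v P₀ Q) (Ioi 0)) ∧
      ∀ τ ∈ stoppingTimes 𝔽, ∀ θ, 0 < ∫ ω, Y (τ ω) ω ∂(κ θ))

end Game

/-! ### Existence and uniqueness of the Drapeau–Kupper function -/

lemma integral_eq_sum (Q : ProbabilityMeasure S) (X : S → ℝ) :
    ∫ θ, X θ ∂(Q : Measure S) = ∑ θ, (Q : Measure S).real {θ} * X θ := by
  rw [integral_fintype .of_finite]; simp

lemma sum_weights (Q : ProbabilityMeasure S) : ∑ θ, (Q : Measure S).real {θ} = 1 := by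
  have := integral_eq_sum Q (fun _ => 1)
  simpa using this.symm

lemma continuous_expect (X : S → ℝ) :
    Continuous fun Q : ProbabilityMeasure S => ∫ θ, X θ ∂(Q : Measure S) := by
  rw [continuous_iff_continuousAt]
  intro Q
  have h := (ProbabilityMeasure.tendsto_iff_forall_integral_tendsto (F := 𝓝 Q)
    (μs := id) (μ := Q)).1 tendsto_id
  exact h (BoundedContinuousFunction.ofNormedAddCommGroupDiscrete X (∑ θ, ‖X θ‖)
    (fun θ => Finset.single_le_sum (f := fun θ => ‖X θ‖) (fun _ _ => norm_nonneg _) (Finset.mem_univ θ)))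

/-- The probability measure with given weights. -/
def ofWeights (q : stdSimplex ℝ S) : ProbabilityMeasure S :=
  ⟨∑ θ, ENNReal.ofReal (q.1 θ) • Measure.dirac θ, ⟨by
    simp only [Measure.coe_finsetSum, Measure.coe_smul, Finset.sum_apply, Pi.smul_apply,
      measure_univ, smul_eq_mul, mul_one]
    rw [← ENNReal.ofReal_sum_of_nonneg (fun i _ => q.2.1 i), q.2.2, ENNReal.ofReal_one]⟩⟩

lemma integral_ofWeights (q : stdSimplex ℝ S) (X : S → ℝ) :
    ∫ θ, X θ ∂(ofWeights q : Measure S) = ∑ θ, q.1 θ * X θ := by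
  change ∫ θ, X θ ∂(∑ θ, ENNReal.ofReal (q.1 θ) • Measure.dirac θ) = _
  rw [integral_finsetSum_measure (fun i _ => (Integrable.smul_measure .of_finite (by simp)))]
  refine Finset.sum_congr rfl fun θ _ => ?_
  rw [integral_smul_measure, integral_dirac, ENNReal.toReal_ofReal (q.2.1 θ), smul_eq_mul]

lemma continuous_ofWeights : Continuous (ofWeights (S := S)) := by
  rw [continuous_iff_continuousAt]
  intro q
  refine (ProbabilityMeasure.tendsto_iff_forall_integral_tendsto).2 fun f => ?_
  simp only [integral_ofWeights]
  exact Continuous.tendsto (continuous_finsetSum _ fun θ _ =>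
    ((continuous_apply θ).comp continuous_subtype_val).mul continuous_const) q

/-- The weights of a probability measure. -/
def weights (Q : ProbabilityMeasure S) : stdSimplex ℝ S :=
  ⟨fun θ => (Q : Measure S).real {θ}, fun _ => measureReal_nonneg, sum_weights Q⟩

lemma ofWeights_weights (Q : ProbabilityMeasure S) : ofWeights (weights Q) = Q := by
  apply Subtype.ext
  change ∑ θ, ENNReal.ofReal ((Q : Measure S).real {θ}) • Measure.dirac θ = (Q : Measure S)
  conv_rhs => rw [← Measure.sum_smul_dirac (Q : Measure S), Measure.sum_fintype]
  simp

/-! ### The function `drapeauKupper` has the four regularity properties -/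

variable {v : ℝ → EReal} {P₀ : ProbabilityMeasure S}

lemma drapeauKupper_le {Q : ProbabilityMeasure S} {s s' : ℝ} (h : s < s') {c : EReal}
    (H : ∀ X : S → ℝ, ∫ θ, X θ ∂(Q : Measure S) ≤ s' → certaintyEquivalent v P₀ X ≤ c) :
    drapeauKupper v P₀ Q s ≤ c :=
  iInf_le_of_le ⟨s', h⟩ (iSup_le fun X => H X.1 X.2)

lemma exists_of_lt_drapeauKupper {Q : ProbabilityMeasure S} {s s' : ℝ} (h : s < s') {c : EReal}
    (H : c < drapeauKupper v P₀ Q s) :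
    ∃ X : S → ℝ, ∫ θ, X θ ∂(Q : Measure S) ≤ s' ∧ c < certaintyEquivalent v P₀ X := by
  by_contra! hc
  exact absurd H (not_lt.2 (drapeauKupper_le h hc))

lemma exists_of_drapeauKupper_lt {Q : ProbabilityMeasure S} {s : ℝ} {c : EReal}
    (H : drapeauKupper v P₀ Q s < c) :
    ∃ s' > s, ∃ c' < c, ∀ X : S → ℝ, ∫ θ, X θ ∂(Q : Measure S) ≤ s' →
      certaintyEquivalent v P₀ X ≤ c' := by
  obtain ⟨⟨s', hs'⟩, h⟩ := iInf_lt_iff.1 H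
  exact ⟨s', hs', _, h, fun X hX => le_iSup_of_le (f := fun X : {X : S → ℝ //
    ∫ θ, X θ ∂(Q : Measure S) ≤ s'} => certaintyEquivalent v P₀ X.1) ⟨X, hX⟩ le_rfl⟩

lemma certaintyEquivalent_le_drapeauKupper (Q : ProbabilityMeasure S) {s : ℝ} {X : S → ℝ}
    (h : ∫ θ, X θ ∂(Q : Measure S) ≤ s) :
    certaintyEquivalent v P₀ X ≤ drapeauKupper v P₀ Q s :=
  le_iInf fun s' => le_iSup_of_le (f := fun X : {X : S → ℝ //
    ∫ θ, X θ ∂(Q : Measure S) ≤ s'} => certaintyEquivalent v P₀ X.1) ⟨X, h.trans (le_of_lt s'.2)⟩ le_rfl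

lemma drapeauKupper_mono (Q : ProbabilityMeasure S) : Monotone (drapeauKupper v P₀ Q) := by
  intro s t hst
  refine le_of_forall_gt fun c hc => ?_
  obtain ⟨s', hs', c', hc', h⟩ := exists_of_drapeauKupper_lt hc
  exact (drapeauKupper_le (hst.trans_lt hs') h).trans_lt hc'

lemma drapeauKupper_rightCont (Q : ProbabilityMeasure S) (s : ℝ) :
    ContinuousWithinAt (drapeauKupper v P₀ Q) (Ici s) s := by
  refine tendsto_order.2 ⟨fun c hc => ?_, fun c hc => ?_⟩
  · filter_upwards [self_mem_nhdsWithin] with t ht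
    exact hc.trans_le (drapeauKupper_mono Q ht)
  · obtain ⟨s', hs', c', hc', h⟩ := exists_of_drapeauKupper_lt hc
    filter_upwards [mem_nhdsWithin_of_mem_nhds (Iio_mem_nhds hs')] with t ht
    exact (drapeauKupper_le ht h).trans_lt hc'

lemma expect_convex_comb {Q₁ Q₂ Q : ProbabilityMeasure S} {a b : NNReal}
    (h : (Q : Measure S) = a • (Q₁ : Measure S) + b • (Q₂ : Measure S)) (X : S → ℝ) :
    ∫ θ, X θ ∂(Q : Measure S) =
      a * ∫ θ, X θ ∂(Q₁ : Measure S) + b * ∫ θ, X θ ∂(Q₂ : Measure S) := by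
  rw [h, integral_add_measure .of_finite .of_finite, integral_smul_nnreal_measure,
    integral_smul_nnreal_measure]
  rfl

lemma drapeauKupper_quasiconvex {Q₁ Q₂ Q : ProbabilityMeasure S} {a b : NNReal} (hab : a + b = 1)
    (h : (Q : Measure S) = a • (Q₁ : Measure S) + b • (Q₂ : Measure S)) (s₁ s₂ : ℝ) :
    drapeauKupper v P₀ Q (a * s₁ + b * s₂) ≤
      max (drapeauKupper v P₀ Q₁ s₁) (drapeauKupper v P₀ Q₂ s₂) := by
  refine le_of_forall_gt fun c hc => ?_
  obtain ⟨t₁, ht₁, c₁, hc₁, h₁⟩ := exists_of_drapeauKupper_lt ((le_max_left _ _).trans_lt hc)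
  obtain ⟨t₂, ht₂, c₂, hc₂, h₂⟩ := exists_of_drapeauKupper_lt ((le_max_right _ _).trans_lt hc)
  have hab' : (a : ℝ) + b = 1 := by exact_mod_cast hab
  have ha := a.2
  have hb := b.2
  have hlt : (a : ℝ) * s₁ + b * s₂ < a * t₁ + b * t₂ := by
    rcases ha.eq_or_lt with h0 | h0
    · have : (a : ℝ) = 0 := h0.symm
      have hb1 : (b : ℝ) = 1 := by linarith
      rw [this, hb1]; linarith
    · have h1 := mul_lt_mul_of_pos_left ht₁ h0
      have h2 := mul_le_mul_of_nonneg_left (le_of_lt ht₂) hb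
      exact add_lt_add_of_lt_of_le h1 h2
  refine (drapeauKupper_le (c := max c₁ c₂) hlt fun X hX => ?_).trans_lt (max_lt hc₁ hc₂)
  rw [expect_convex_comb h] at hX
  by_cases hX1 : ∫ θ, X θ ∂(Q₁ : Measure S) ≤ t₁
  · exact (h₁ X hX1).trans (le_max_left _ _)
  by_cases hX2 : ∫ θ, X θ ∂(Q₂ : Measure S) ≤ t₂
  · exact (h₂ X hX2).trans (le_max_right _ _)
  push Not at hX1 hX2
  exfalso
  rcases ha.eq_or_lt with h0 | h0
  · have h0' : (a : ℝ) = 0 := h0.symm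
    have hb1 : (b : ℝ) = 1 := by linarith
    rw [h0', hb1] at hX; linarith
  · have h1 := mul_lt_mul_of_pos_left hX1 h0
    have h2 := mul_le_mul_of_nonneg_left (le_of_lt hX2) hb
    have := add_lt_add_of_lt_of_le h1 h2
    exact absurd hX (not_le.2 this)

lemma drapeauKupper_limit (Q : ProbabilityMeasure S) :
    Tendsto (drapeauKupper v P₀ Q) atTop (𝓝 (⨆ X, certaintyEquivalent v P₀ X)) := by
  have : (⨆ X, certaintyEquivalent v P₀ X) = ⨆ s, drapeauKupper v P₀ Q s := by
    apply le_antisymm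
    · exact iSup_le fun X => le_iSup_of_le _ (certaintyEquivalent_le_drapeauKupper Q le_rfl)
    · exact iSup_le fun s => drapeauKupper_le (lt_add_one s) fun X _ => le_iSup _ X
  rw [this]
  exact tendsto_atTop_iSup (drapeauKupper_mono Q)

lemma drapeauKupper_lsc (s : ℝ) :
    LowerSemicontinuous fun Q => ⨆ s' : Iio s, drapeauKupper v P₀ Q s' := by
  intro Q c hc
  obtain ⟨⟨s', hs'⟩, h⟩ := lt_iSup_iff.1 hc
  obtain ⟨t, hst, hts⟩ := exists_between (show s' < s from hs')
  obtain ⟨X, hX, hcX⟩ := exists_of_lt_drapeauKupper hst h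
  obtain ⟨t', htt', hts'⟩ := exists_between hts
  filter_upwards [(continuous_expect X).continuousAt.eventually_lt
    (continuousAt_const (y := t')) (hX.trans_lt htt')] with Q' hQ'
  exact lt_iSup_iff.2 ⟨⟨t', hts'⟩, hcX.trans_le (certaintyEquivalent_le_drapeauKupper Q' hQ'.le)⟩

/-! ### The robust representation -/

/-- The expected utility `∫ v(X) dP₀`. -/
def expUtility (v : ℝ → EReal) (P₀ : ProbabilityMeasure S) (X : S → ℝ) : EReal :=
  ∑ θ, (((P₀ : Measure S).real {θ} : ℝ) : EReal) * v (X θ)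

lemma le_certaintyEquivalent_iff (hv : Monotone v) {c : ℝ} {X : S → ℝ} :
    (c : EReal) ≤ certaintyEquivalent v P₀ X ↔ ∀ z : ℝ, z < c → v z ≤ expUtility v P₀ X := by
  constructor
  · intro h z hz
    obtain ⟨⟨x, hx⟩, hzx⟩ := lt_iSup_iff.1 ((EReal.coe_lt_coe_iff.2 hz).trans_le h)
    exact (hv (EReal.coe_lt_coe_iff.1 hzx).le).trans hx
  · intro h
    by_contra! hc
    obtain ⟨z, hz₁, hz₂⟩ := EReal.lt_iff_exists_real_btwn.1 hc
    exact absurd hz₁ (not_lt.2 (le_iSup_of_le (f := fun x : {x : ℝ // v x ≤ expUtility v P₀ X} =>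
      ((x : ℝ) : EReal)) ⟨z, h z (EReal.coe_lt_coe_iff.1 hz₂)⟩ le_rfl))

lemma expUtility_mono (hv : Monotone v) {X X' : S → ℝ} (h : X ≤ X') :
    expUtility v P₀ X ≤ expUtility v P₀ X' :=
  Finset.sum_le_sum fun θ _ => mul_le_mul_of_nonneg_left (hv (h θ))
    (EReal.coe_nonneg.2 measureReal_nonneg)

lemma coe_sum (f : S → ℝ) : ((∑ θ, f θ : ℝ) : EReal) = ∑ θ, (f θ : EReal) := by
  induction (Finset.univ : Finset S) using Finset.cons_induction with
  | empty => simp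
  | cons a s ha ih => simp [Finset.sum_cons, ih]

lemma le_expUtility_iff (hv : IsAmbiguityFunction v) {a : ℝ} {X : S → ℝ} :
    (a : EReal) ≤ expUtility v P₀ X ↔ ∃ r : S → ℝ,
      (∀ θ, 0 < (P₀ : Measure S).real {θ} → (r θ : EReal) ≤ v (X θ)) ∧
        a ≤ ∑ θ, (P₀ : Measure S).real {θ} * r θ := by
  classical
  constructor
  · intro h
    have hne : ∀ θ, 0 < (P₀ : Measure S).real {θ} → v (X θ) ≠ ⊥ := by
      intro θ hθ hbot
      rw [expUtility, ← Finset.add_sum_erase _ _ (Finset.mem_univ θ), hbot,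
        EReal.coe_mul_bot_of_pos hθ, EReal.bot_add] at h
      simp at h
    refine ⟨fun θ => (v (X θ)).toReal, fun θ hθ =>
      (EReal.coe_toReal (hv.ne_top _) (hne θ hθ)).le, ?_⟩
    rw [← EReal.coe_le_coe_iff, coe_sum]
    refine h.trans (Finset.sum_le_sum fun θ _ => ?_)
    rcases (measureReal_nonneg (μ := (P₀ : Measure S)) (s := {θ})).eq_or_lt with h0 | h0
    · simp [← h0]
    · rw [EReal.coe_mul, EReal.coe_toReal (hv.ne_top _) (hne θ h0)]
  · rintro ⟨r, hr, ha⟩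
    refine (EReal.coe_le_coe_iff.2 ha).trans ?_
    rw [coe_sum]
    refine Finset.sum_le_sum fun θ _ => ?_
    rcases (measureReal_nonneg (μ := (P₀ : Measure S)) (s := {θ})).eq_or_lt with h0 | h0
    · simp [← h0]
    · rw [EReal.coe_mul]
      exact mul_le_mul_of_nonneg_left (hr θ h0) (EReal.coe_nonneg.2 h0.le)

lemma convex_expUtility (hv : IsAmbiguityFunction v) (z : ℝ) :
    Convex ℝ {X : S → ℝ | v z ≤ expUtility v P₀ X} := by
  by_cases hz : v z = ⊥
  · simp [hz, convex_univ]
  intro X hX X' hX' α β hα hβ hαβ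
  rw [mem_ofPred_eq, ← EReal.coe_toReal (hv.ne_top z) hz, le_expUtility_iff hv] at hX hX' ⊢
  obtain ⟨r, hr, ha⟩ := hX
  obtain ⟨r', hr', ha'⟩ := hX'
  refine ⟨fun θ => α * r θ + β * r' θ, fun θ hθ => ?_, ?_⟩
  · exact hv.concave (x := (X θ, r θ)) (hr θ hθ) (y := (X' θ, r' θ)) (hr' θ hθ) hα hβ hαβ
  · have : ∑ θ, (P₀ : Measure S).real {θ} * (α * r θ + β * r' θ) =
        α * ∑ θ, (P₀ : Measure S).real {θ} * r θ + β * ∑ θ, (P₀ : Measure S).real {θ} * r' θ := by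
      rw [Finset.mul_sum, Finset.mul_sum, ← Finset.sum_add_distrib]
      exact Finset.sum_congr rfl fun θ _ => by ring
    rw [this]
    have h1 := mul_le_mul_of_nonneg_left ha hα
    have h2 := mul_le_mul_of_nonneg_left ha' hβ
    have : (v z).toReal = α * (v z).toReal + β * (v z).toReal := by rw [← add_mul, hαβ, one_mul]
    linarith

lemma usc_mul {p : ℝ} (hp : 0 ≤ p) {f : (S → ℝ) → EReal} (hf : UpperSemicontinuous f) :
    UpperSemicontinuous fun X => (p : EReal) * f X := by
  rcases hp.eq_or_lt with rfl | hp
  · simpa using upperSemicontinuous_const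
  · refine Continuous.comp_upperSemicontinuous (g := fun x : EReal => (p : EReal) * x) ?_ hf
      (fun a b h => mul_le_mul_of_nonneg_left h (EReal.coe_nonneg.2 hp.le))
    rw [continuous_iff_continuousAt]
    intro x
    exact (EReal.continuousAt_mul (p := ((p : EReal), x)) (.inl (EReal.coe_ne_zero.2 hp.ne'))
      (.inl (EReal.coe_ne_zero.2 hp.ne')) (by left; simp)
      (by left; simp)).comp (continuousAt_const.prodMk continuousAt_id)

lemma usc_expUtility (hv : IsAmbiguityFunction v) :
    UpperSemicontinuous fun X : S → ℝ => expUtility v P₀ X := by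
  have hterm : ∀ θ, UpperSemicontinuous fun X : S → ℝ =>
      (((P₀ : Measure S).real {θ} : ℝ) : EReal) * v (X θ) := fun θ =>
    usc_mul measureReal_nonneg (hv.usc.comp (continuous_apply θ))
  have htop : ∀ θ (X : S → ℝ), (((P₀ : Measure S).real {θ} : ℝ) : EReal) * v (X θ) ≠ ⊤ := by
    intro θ X
    rcases (measureReal_nonneg (μ := (P₀ : Measure S)) (s := {θ})).eq_or_lt with h0 | h0
    · simp [← h0]
    · rw [Ne, EReal.mul_eq_top]
      simp [hv.ne_top]
  have key : ∀ s : Finset S, UpperSemicontinuous (fun X : S → ℝ =>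
      ∑ θ ∈ s, (((P₀ : Measure S).real {θ} : ℝ) : EReal) * v (X θ)) ∧
      ∀ X : S → ℝ, ∑ θ ∈ s, (((P₀ : Measure S).real {θ} : ℝ) : EReal) * v (X θ) ≠ ⊤ := by
    intro s
    induction s using Finset.cons_induction with
    | empty => exact ⟨by simpa using upperSemicontinuous_const, by simp⟩
    | cons a s ha ih =>
      simp only [Finset.sum_cons]
      refine ⟨(hterm a).add' ih.1 fun X => ?_, fun X => EReal.add_ne_top (htop a X) (ih.2 X)⟩
      exact EReal.continuousAt_add (.inl (htop a X)) (.inr (ih.2 X))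
  exact (key Finset.univ).1

lemma superlevel_convex (hv : IsAmbiguityFunction v) (c : ℝ) :
    Convex ℝ {X : S → ℝ | (c : EReal) ≤ certaintyEquivalent v P₀ X} := by
  simp only [le_certaintyEquivalent_iff hv.monotone, ofPred_forall]
  exact convex_iInter fun z => convex_iInter fun _ => convex_expUtility hv z

lemma superlevel_closed (hv : IsAmbiguityFunction v) (c : ℝ) :
    IsClosed {X : S → ℝ | (c : EReal) ≤ certaintyEquivalent v P₀ X} := by
  simp only [le_certaintyEquivalent_iff hv.monotone, ofPred_forall]
  exact isClosed_iInter fun z => isClosed_iInter fun _ =>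
    (usc_expUtility hv).isClosed_preimage (v z)

lemma dual_apply (f : StrongDual ℝ (S → ℝ)) [DecidableEq S] (X : S → ℝ) :
    f X = ∑ θ, f (Pi.single θ 1) * X θ := by
  conv_lhs => rw [pi_eq_sum_univ' X]
  rw [map_sum]
  refine Finset.sum_congr rfl fun θ _ => ?_
  rw [map_smul, smul_eq_mul, mul_comm]

lemma drapeauKupper_representation (hv : IsAmbiguityFunction v) (X : S → ℝ) :
    certaintyEquivalent v P₀ X =
      ⨅ Q : ProbabilityMeasure S, drapeauKupper v P₀ Q (∫ θ, X θ ∂(Q : Measure S)) := by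
  classical
  refine le_antisymm (le_iInf fun Q => certaintyEquivalent_le_drapeauKupper Q le_rfl) ?_
  by_contra! hlt
  obtain ⟨c, hc₁, hc₂⟩ := EReal.lt_iff_exists_real_btwn.1 hlt
  suffices ∃ Q : ProbabilityMeasure S,
      drapeauKupper v P₀ Q (∫ θ, X θ ∂(Q : Measure S)) ≤ c by
    obtain ⟨Q, hQ⟩ := this
    exact absurd (hc₂.trans_le (iInf_le_of_le Q hQ)) (lt_irrefl _)
  set A := {X : S → ℝ | (c : EReal) ≤ certaintyEquivalent v P₀ X} with hA
  obtain hAe | ⟨B, hB⟩ := A.eq_empty_or_nonempty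
  · refine ⟨P₀, drapeauKupper_le (lt_add_one _) fun X' _ => ?_⟩
    by_contra! h
    have : X' ∈ A := h.le
    simp [hAe] at this
  obtain ⟨f, u, hfX, hfA⟩ := geometric_hahn_banach_point_closed (superlevel_convex hv c)
    (superlevel_closed hv c) (show X ∉ A from not_le.2 hc₁)
  have hup : ∀ X' ∈ A, ∀ X'', X' ≤ X'' → X'' ∈ A := fun X' h' X'' hle =>
    (le_certaintyEquivalent_iff hv.monotone).2 fun z hz =>
      ((le_certaintyEquivalent_iff hv.monotone).1 h' z hz).trans (expUtility_mono hv.monotone hle)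
  have hw : ∀ θ, 0 ≤ f (Pi.single θ 1) := by
    intro θ
    by_contra! hneg
    obtain ⟨n, hn⟩ := exists_nat_gt ((f B - u) / (-f (Pi.single θ 1)))
    have hmem := hfA _ (hup B hB (B + (n : ℝ) • Pi.single θ 1)
      (le_add_of_nonneg_right (smul_nonneg n.cast_nonneg (Pi.single_nonneg.2 zero_le_one))))
    rw [map_add, map_smul, smul_eq_mul] at hmem
    rw [div_lt_iff₀ (by linarith)] at hn
    linarith
  set W := ∑ θ, f (Pi.single θ 1) with hW
  have hWpos : 0 < W := by
    refine (Finset.sum_nonneg fun θ _ => hw θ).lt_of_ne fun h0 => ?_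
    have hz := (Finset.sum_eq_zero_iff_of_nonneg (fun θ _ => hw θ)).1 h0.symm
    have h1 : ∀ X', f X' = 0 := fun X' => by
      rw [dual_apply]
      exact Finset.sum_eq_zero fun θ hθ => by rw [hz θ hθ, zero_mul]
    have h2 := hfA B hB
    rw [h1] at h2 hfX
    linarith
  let q : stdSimplex ℝ S := ⟨fun θ => f (Pi.single θ 1) / W, fun θ => div_nonneg (hw θ) hWpos.le, by
    rw [← Finset.sum_div, div_self hWpos.ne']⟩
  have hq : ∀ X' : S → ℝ, ∫ θ, X' θ ∂(ofWeights q : Measure S) = f X' / W := by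
    intro X'
    rw [integral_ofWeights, dual_apply f X', Finset.sum_div]
    exact Finset.sum_congr rfl fun θ _ => by simp only [q]; ring
  refine ⟨ofWeights q, drapeauKupper_le (s' := u / W) ?_ fun X' hX' => ?_⟩
  · rw [hq]; exact div_lt_div_of_pos_right hfX hWpos
  · by_contra! h
    have h1 := hfA X' h.le
    rw [hq, div_le_div_iff_of_pos_right hWpos] at hX'
    linarith

lemma isDrapeauKupper_drapeauKupper (hv : IsAmbiguityFunction v) :
    IsDrapeauKupper v P₀ (drapeauKupper v P₀) where
  representation := drapeauKupper_representation hv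
  monotone := drapeauKupper_mono
  right_continuous := drapeauKupper_rightCont
  quasiconvex _ _ _ _ _ hab h := drapeauKupper_quasiconvex hab h
  limit := ⟨_, drapeauKupper_limit⟩
  lsc := drapeauKupper_lsc

/-! ### Uniqueness -/

lemma ofWeights_convex_comb {q q' q'' : stdSimplex ℝ S} {a b : NNReal}
    (h : q''.1 = (a : ℝ) • q.1 + (b : ℝ) • q'.1) :
    (ofWeights q'' : Measure S) = a • (ofWeights q : Measure S) + b • (ofWeights q' : Measure S) := by
  change ∑ θ, ENNReal.ofReal (q''.1 θ) • Measure.dirac θ =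
    a • (∑ θ, ENNReal.ofReal (q.1 θ) • Measure.dirac θ) +
      b • (∑ θ, ENNReal.ofReal (q'.1 θ) • Measure.dirac θ)
  rw [Finset.smul_sum, Finset.smul_sum, ← Finset.sum_add_distrib]
  refine Finset.sum_congr rfl fun θ _ => ?_
  rw [h]
  simp only [Pi.add_apply, Pi.smul_apply, smul_eq_mul]
  rw [ENNReal.ofReal_add (mul_nonneg a.coe_nonneg (q.2.1 θ)) (mul_nonneg b.coe_nonneg (q'.2.1 θ)),
    ENNReal.ofReal_mul a.coe_nonneg, ENNReal.ofReal_mul b.coe_nonneg, add_smul, ENNReal.ofReal_coe_nnreal,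
    ENNReal.ofReal_coe_nnreal, mul_smul, mul_smul]
  rfl

variable {R : ProbabilityMeasure S → ℝ → EReal}

/-- The set of pairs `(Q, s)` such that `R Q s' ≤ c` for all `s' < s`. -/
def sublevel (R : ProbabilityMeasure S → ℝ → EReal) (c : EReal) : Set ((S → ℝ) × ℝ) :=
  {p | ∃ hq : p.1 ∈ stdSimplex ℝ S, ∀ s' < p.2, R (ofWeights ⟨p.1, hq⟩) s' ≤ c}

lemma sublevel_convex (hR : IsDrapeauKupper v P₀ R) (c : EReal) : Convex ℝ (sublevel R c) := by
  rintro ⟨q, s⟩ ⟨hq, hs⟩ ⟨q', s'⟩ ⟨hq', hs'⟩ a b ha hb hab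
  refine ⟨convex_stdSimplex ℝ S hq hq' ha hb hab, fun t ht => ?_⟩
  lift a to NNReal using ha
  lift b to NNReal using hb
  simp only [Prod.smul_mk, Prod.mk_add_mk, smul_eq_mul] at ht hs hs' ⊢
  set δ := a * s + b * s' - t with hδ
  have hδpos : 0 < δ := by rw [hδ]; linarith
  have heq : t = a * (s - δ) + b * (s' - δ) := by
    have : δ = (a + b) * δ := by rw [hab, one_mul]
    linarith
  rw [heq]
  refine (hR.quasiconvex (ofWeights ⟨q, hq⟩) (ofWeights ⟨q', hq'⟩) _ a b (by exact_mod_cast hab)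
    (ofWeights_convex_comb rfl) _ _).trans (max_le (hs _ (by linarith)) (hs' _ (by linarith)))

lemma sublevel_closed (hR : IsDrapeauKupper v P₀ R) (c : EReal) : IsClosed (sublevel R c) := by
  have heq : sublevel R c = ⋂ t : ℝ, ((stdSimplex ℝ S) ×ˢ Iic t ∪
      (Subtype.val '' {q : stdSimplex ℝ S | (⨆ s' : Iio t, R (ofWeights q) s') ≤ c}) ×ˢ univ) := by
    ext ⟨q, s⟩
    simp only [mem_iInter]
    constructor
    · rintro ⟨hq, hs⟩ t
      rcases le_or_gt s t with hst | hst
      · exact .inl ⟨hq, hst⟩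
      · exact .inr ⟨⟨⟨q, hq⟩, iSup_le fun s' => hs _ (lt_trans s'.2 hst), rfl⟩, mem_univ _⟩
    · intro h
      have hq : q ∈ stdSimplex ℝ S := by
        rcases h 0 with h | ⟨⟨q', _, rfl⟩, _⟩
        · exact h.1
        · exact q'.2
      refine ⟨hq, fun s' hs' => ?_⟩
      obtain ⟨t, hst, hts⟩ := exists_between (show s' < s from hs')
      rcases h t with h | ⟨⟨q', hq', rfl⟩, _⟩
      · exact absurd hts (not_lt.2 h.2)
      · exact (le_iSup (fun s' : Iio t => R (ofWeights q') s') ⟨s', hst⟩).trans hq'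
  rw [heq]
  refine isClosed_iInter fun t => (IsClosed.prod (isClosed_stdSimplex ℝ S) isClosed_Iic).union
    (IsClosed.prod ?_ isClosed_univ)
  exact (isClosed_stdSimplex ℝ S).isClosedEmbedding_subtypeVal.isClosedMap _
    (((hR.lsc t).comp continuous_ofWeights).isClosed_preimage c)

lemma sublevel_bounded (hR : IsDrapeauKupper v P₀ R) {c : EReal} {Q₀ : ProbabilityMeasure S}
    {s₀ : ℝ} (h : c < R Q₀ s₀) : ∃ N : ℝ, ∀ p ∈ sublevel R c, p.2 ≤ N := by
  obtain ⟨l, hl⟩ := hR.limit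
  have hcl : c < l := h.trans_le ((hR.monotone Q₀).ge_of_tendsto (hl Q₀) s₀)
  let V : ℕ → Set (stdSimplex ℝ S) := fun n => {q | c < ⨆ s' : Iio (n : ℝ), R (ofWeights q) s'}
  have hVo : ∀ n, IsOpen (V n) := fun n =>
    (((hR.lsc n).comp continuous_ofWeights).isOpen_preimage c)
  have hVm : Monotone V := by
    intro m n hmn q hq
    have hq' : c < ⨆ s' : Iio (m : ℝ), R (ofWeights q) s' := hq
    change c < ⨆ s' : Iio (n : ℝ), R (ofWeights q) s'
    refine hq'.trans_le (iSup_le fun s' => le_iSup (fun s' : Iio (n : ℝ) =>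
      R (ofWeights q) s') ⟨s'.1, show (s' : ℝ) < n from lt_of_lt_of_le s'.2 (Nat.cast_le.2 hmn)⟩)
  have hVc : univ ⊆ ⋃ n, V n := by
    intro q _
    obtain ⟨s, hs⟩ := ((hl (ofWeights q)).eventually_const_lt hcl).exists
    obtain ⟨n, hn⟩ := exists_nat_gt s
    refine mem_iUnion.2 ⟨n, ?_⟩
    change c < ⨆ s' : Iio (n : ℝ), R (ofWeights q) s'
    exact lt_iSup_iff.2 ⟨⟨s, hn⟩, hs⟩
  obtain ⟨n, hn⟩ := isCompact_univ.elim_directed_cover V hVo hVc hVm.directed_le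
  refine ⟨n, ?_⟩
  rintro ⟨q, s⟩ ⟨hq, hs⟩
  by_contra! hlt
  have h1 : c < ⨆ s' : Iio (n : ℝ), R (ofWeights ⟨q, hq⟩) s' := hn (mem_univ (⟨q, hq⟩ : stdSimplex ℝ S))
  exact absurd h1 (not_lt.2 (iSup_le fun s' => hs _ (lt_trans s'.2 hlt)))

lemma le_of_majorant (hR : IsDrapeauKupper v P₀ R) {c : EReal} {X : S → ℝ}
    (h : ∀ p ∈ sublevel R c, p.2 ≤ ∑ θ, p.1 θ * X θ) : c ≤ certaintyEquivalent v P₀ X := by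
  rw [hR.representation]
  refine le_iInf fun Q => ?_
  by_contra! hlt
  have hev := (hR.right_continuous Q (∫ θ, X θ ∂(Q : Measure S))).eventually_lt_const hlt
  obtain ⟨t, ht, hRt⟩ : ∃ t > ∫ θ, X θ ∂(Q : Measure S), R Q t < c := by
    have := (hev.filter_mono (nhdsWithin_mono _ Ioi_subset_Ici_self)).and self_mem_nhdsWithin
    obtain ⟨t, h1, h2⟩ := this.exists
    exact ⟨t, h2, h1⟩
  have := h ((weights Q).1, t) ⟨(weights Q).2, fun s' hs' => by
    rw [show (⟨(weights Q).1, (weights Q).2⟩ : stdSimplex ℝ S) = weights Q from rfl,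
      ofWeights_weights]
    exact (hR.monotone Q (le_of_lt hs')).trans hRt.le⟩
  rw [integral_eq_sum] at ht
  exact absurd this (not_le.2 ht)

lemma exists_majorant (hR : IsDrapeauKupper v P₀ R) {c : EReal} {Q₀ : ProbabilityMeasure S}
    {s₀ s₁ : ℝ} (h : c < R Q₀ s₀) (hs : s₀ < s₁) :
    ∃ X : S → ℝ, ∫ θ, X θ ∂(Q₀ : Measure S) ≤ s₁ ∧
      ∀ p ∈ sublevel R c, p.2 ≤ ∑ θ, p.1 θ * X θ := by
  classical
  rw [← ofWeights_weights Q₀] at h ⊢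
  generalize weights Q₀ = q₀ at h ⊢
  simp only [integral_ofWeights]
  obtain ⟨N, hN⟩ := sublevel_bounded hR h
  have hnot : (q₀.1, s₁) ∉ sublevel R c := fun ⟨_, hle⟩ => absurd h (not_lt.2 (hle s₀ hs))
  obtain hBe | ⟨⟨q₁, t₁⟩, hB⟩ := (sublevel R c).eq_empty_or_nonempty
  · refine ⟨fun _ => s₁, ?_, by simp [hBe]⟩
    rw [← Finset.sum_mul, q₀.2.2, one_mul]
  obtain ⟨f, u, hf₀, hfB⟩ := geometric_hahn_banach_point_closed (sublevel_convex hR c)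
    (sublevel_closed hR c) hnot
  let g : StrongDual ℝ (S → ℝ) := f.comp (ContinuousLinearMap.inl ℝ (S → ℝ) ℝ)
  have hfg : ∀ q s, f (q, s) = g q + s * f (0, 1) := by
    intro q s
    have : (q, s) = (q, 0) + s • ((0, 1) : (S → ℝ) × ℝ) := by simp
    rw [this, map_add, map_smul]
    rfl
  set β := f (0, 1) with hβ
  set X : S → ℝ := fun θ => g (Pi.single θ 1) with hX
  have hgX : ∀ q, g q = ∑ θ, q θ * X θ := fun q => by
    rw [dual_apply]
    exact Finset.sum_congr rfl fun θ _ => mul_comm _ _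
  have haff : ∀ (m k : ℝ) (q : S → ℝ), q ∈ stdSimplex ℝ S →
      ∑ θ, q θ * (m * X θ + k) = m * g q + k := by
    intro m k q hq
    rw [hgX, Finset.mul_sum]
    simp only [mul_add, Finset.sum_add_distrib]
    rw [← Finset.sum_mul, hq.2, one_mul]
    congr 1
    exact Finset.sum_congr rfl fun θ _ => by ring
  have hβ0 : β ≤ 0 := by
    by_contra! hpos
    obtain ⟨n, hn⟩ := exists_nat_gt ((g q₁ + t₁ * β - u) / β)
    obtain ⟨hq₁, ht₁⟩ := hB
    have hle : (t₁ - n : ℝ) ≤ t₁ := by linarith [(n.cast_nonneg : (0 : ℝ) ≤ n)]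
    have := hfB (q₁, t₁ - n) ⟨hq₁, fun s' hs' => ht₁ s' (lt_of_lt_of_le hs' hle)⟩
    rw [hfg] at this
    rw [div_lt_iff₀ hpos] at hn
    linarith
  rw [hfg] at hf₀
  rcases hβ0.lt_or_eq with hneg | hzero
  · have hp : 0 < -β := by linarith
    refine ⟨fun θ => (-β)⁻¹ * X θ + (-β)⁻¹ * (-u), ?_, ?_⟩
    · rw [haff _ _ _ q₀.2, ← mul_add, inv_mul_le_iff₀ hp]
      linarith
    · rintro ⟨q, s⟩ hqs
      have hlt := hfB _ hqs
      rw [hfg] at hlt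
      rw [haff _ _ _ hqs.1, ← mul_add, le_inv_mul_iff₀ hp]
      linarith
  · rw [hzero, mul_zero, add_zero] at hf₀
    have hd : 0 < u - g q₀.1 := by linarith
    set m := max 0 ((N - s₁) / (u - g q₀.1)) with hm
    have hm0 : 0 ≤ m := le_max_left _ _
    refine ⟨fun θ => m * X θ + (N - m * u), ?_, ?_⟩
    · rw [haff _ _ _ q₀.2]
      have : (N - s₁) / (u - g q₀.1) ≤ m := le_max_right _ _
      rw [div_le_iff₀ hd] at this
      linarith
    · rintro ⟨q, s⟩ hqs
      have hlt := hfB _ hqs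
      rw [hfg, hzero, mul_zero, add_zero] at hlt
      rw [haff _ _ _ hqs.1]
      have h1 := hN _ hqs
      have h2 := mul_le_mul_of_nonneg_left hlt.le hm0
      simp only at h1 ⊢
      linarith

/-- For an ambiguity function `v`, `drapeauKupper v P₀` is the unique function which represents the
certainty equivalent and has the four regularity properties. -/
theorem isDrapeauKupper_iff (hv : IsAmbiguityFunction v) :
    IsDrapeauKupper v P₀ R ↔ R = drapeauKupper v P₀ := by
  refine ⟨fun hR => ?_, fun h => h ▸ isDrapeauKupper_drapeauKupper hv⟩
  funext Q s
  refine le_antisymm ?_ ?_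
  · by_contra! hlt
    obtain ⟨c, hc₁, hc₂⟩ := exists_between hlt
    obtain ⟨s₁, hs₁, c', hc', H⟩ := exists_of_drapeauKupper_lt hc₁
    obtain ⟨X, hX, hmaj⟩ := exists_majorant hR hc₂ hs₁
    exact absurd ((le_of_majorant hR hmaj).trans (H X hX)) (not_le.2 hc')
  · refine le_of_forall_gt fun c hc => ?_
    have hev := (hR.right_continuous Q s).eventually_lt_const hc
    have := (hev.filter_mono (nhdsWithin_mono _ Ioi_subset_Ici_self)).and self_mem_nhdsWithin
    obtain ⟨t, h1, h2⟩ := this.exists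
    refine (drapeauKupper_le (show s < t from h2) fun X hX => ?_).trans_lt h1
    rw [hR.representation]
    exact (iInf_le _ Q).trans (hR.monotone Q hX)

end

end AmbiguityStopping

open AmbiguityStopping

/-! The payoff sees a stopping time `τ` only through the vector `x` of scenario expectations
`E^θ[Y_τ]`: it equals `R(Q, ∫ x dQ)`. So the game can be played on `M(S) × K`, where `K` is the set
of vectors attainable by grid stopping times. In `Q` the payoff is quasi-convex, and it is lower
semicontinuous by property (iv) together with left-continuity of `R(Q, ·)`. In `x` it is a
nondecreasing right-continuous function of a linear form, hence quasi-concave and upper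
semicontinuous. Sion's theorem then yields a saddle point, provided that `K` is compact and convex.

That `K` is compact and convex (`isCompact_convex_attainable`) is the heart of the matter, an
argument of Lyapunov and Dvoretzky–Wald–Wolfowitz type. Randomized rules `ψ i ≥ 0`, `∑ ψ i = 1`,
with `ψ i` measurable for the information at time `i`, form a closed bounded convex subset of a
Hilbert space. It is weakly compact, so its image under the finitely many expectation functionals is
compact and convex.

Randomization gains nothing: each fibre of these functionals has an extreme point, and an extreme
point takes only the values 0 and 1 (`ae_zero_or_one_of_extreme`). Otherwise, at the first time `i`
with `0 < ψ i < 1` on a non-null set, that set contains more disjoint non-null pieces than there are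
functionals. Shifting mass between `i` and later times with separate signed amplitudes on the pieces
gives, by counting dimensions, a nonzero move that preserves all expectations and is admissible in
both directions, contradicting extremality. -/

namespace AmbiguityStopping

/-! ### Weak compactness and extreme points in Hilbert space -/

section Hilbert

variable {H : Type*} [NormedAddCommGroup H] [InnerProductSpace ℝ H] {ι : Type*}

/-- Each coordinate is a bounded functional, so weakly continuous, and the target carries the
product topology. -/
lemma continuous_comp_toWeakSpace_symm (L : H →L[ℝ] (ι → ℝ)) :
    Continuous fun x => L ((toWeakSpace ℝ H).symm x) := by
  refine continuous_pi fun i => ?_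
  exact WeakBilin.eval_continuous (topDualPairing ℝ H).flip
    ((ContinuousLinearMap.proj i : (ι → ℝ) →L[ℝ] ℝ).comp L)

variable [CompleteSpace H]

/-- Hilbert spaces are reflexive. -/
lemma surjective_inclusionInDoubleDual :
    Function.Surjective (NormedSpace.inclusionInDoubleDual ℝ H) := by
  intro φ
  let e := InnerProductSpace.toDual ℝ H
  let y := e.symm ⟨⟨⟨fun x => φ (e x), by simp⟩, by simp⟩, φ.continuous.comp e.continuous⟩
  refine ⟨y, ?_⟩
  ext f
  obtain ⟨x, rfl⟩ := e.surjective f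
  have : e y x = φ (e x) := by
    simp only [y, LinearIsometryEquiv.apply_symm_apply]
    rfl
  rw [NormedSpace.dual_def, ← this]
  simp only [e, InnerProductSpace.toDual_apply_apply]
  exact real_inner_comm _ _

/-- By reflexivity, Banach–Alaoglu makes the weak closure of a bounded set compact; by Mazur's
theorem a closed convex set is its own weak closure. -/
lemma isCompact_toWeakSpace_image {C : Set H} (hC : Convex ℝ C) (hc : IsClosed C)
    (hb : Bornology.IsBounded C) : IsCompact (toWeakSpace ℝ H '' C) := by
  have h := NormedSpace.isCompact_closure_of_isBounded ℝ H (toWeakSpace ℝ H '' C)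
    (by rwa [preimage_image_eq _ (toWeakSpace ℝ H).injective]) fun φ _ => by
      obtain ⟨y, hy⟩ := surjective_inclusionInDoubleDual (H := H) (WeakDual.toStrongDual φ)
      exact ⟨toWeakSpace ℝ H y, by
        apply WeakDual.toStrongDual.injective
        rw [← hy]; rfl⟩
  rwa [← hC.toWeakSpace_closure ℝ, hc.closure_eq] at h

lemma isCompact_image_of_convex {C : Set H} (hC : Convex ℝ C) (hc : IsClosed C)
    (hb : Bornology.IsBounded C) (L : H →L[ℝ] (ι → ℝ)) : IsCompact (L '' C) := by
  have := (isCompact_toWeakSpace_image hC hc hb).image (continuous_comp_toWeakSpace_symm L)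
  rwa [image_image] at this

/-- A fibre over a closed bounded convex set of a continuous linear map has an extreme point. -/
lemma exists_extremePoint_fiber {C : Set H} (hC : Convex ℝ C) (hc : IsClosed C)
    (hb : Bornology.IsBounded C) (L : H →L[ℝ] (ι → ℝ)) {x : H} (hx : x ∈ C) :
    ∃ y ∈ C, L y = L x ∧ ∀ h, y + h ∈ C → y - h ∈ C → L h = 0 → h = 0 := by
  have hC' : Convex ℝ (C ∩ L ⁻¹' {L x}) :=
    hC.inter ((convex_singleton _).linear_preimage L.toLinearMap)
  have hc' : IsClosed (C ∩ L ⁻¹' {L x}) := hc.inter (isClosed_singleton.preimage L.continuous)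
  have : LocallyConvexSpace ℝ (WeakSpace ℝ H) :=
    inferInstanceAs (LocallyConvexSpace ℝ (WeakBilin (topDualPairing ℝ H).flip))
  -- Krein–Milman is applied in the weak topology, since the fibre need not be norm compact.
  obtain ⟨y', hy'⟩ := (isCompact_toWeakSpace_image hC' hc'
    (hb.subset inter_subset_left)).extremePoints_nonempty (by exact ⟨_, x, ⟨hx, rfl⟩, rfl⟩)
  obtain ⟨⟨y, ⟨hy, hLy⟩, rfl⟩, hext⟩ := hy'
  refine ⟨y, hy, hLy, fun h h₁ h₂ h₀ => ?_⟩
  have h₁' : y + h ∈ C ∩ L ⁻¹' {L x} := ⟨h₁, by simpa [h₀] using hLy⟩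
  have h₂' : y - h ∈ C ∩ L ⁻¹' {L x} := ⟨h₂, by simpa [h₀] using hLy⟩
  have := hext (mem_image_of_mem _ h₁') (mem_image_of_mem _ h₂') ⟨1/2, 1/2, by norm_num, by norm_num,
    by norm_num, by
      rw [← map_smul, ← map_smul, ← map_add]
      congr 1
      module⟩
  have := (toWeakSpace ℝ H).injective this
  simpa using this

end Hilbert

/-! ### Integral functionals, randomized stopping rules and non-atomicity -/

section Relaxed

variable {Ω : Type*} {mΩ : MeasurableSpace Ω}

/-- The weight `|g|` is absorbed into `ν`, after which Hölder compares the `L¹(ν)` and `L²(ν)`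
norms. This bounds `f ↦ ∫ f g dμ` on `L²(ν)` without asking `g` to be square integrable. -/
lemma lintegral_enorm_mul_le {μ ν : Measure Ω} {g : Ω → ℝ} (hg : Measurable g)
    (hμ : μ ≪ ν) (hgν : μ.withDensity (fun ω => ‖g ω‖ₑ) ≤ ν) (f : Lp ℝ 2 ν) :
    ∫⁻ ω, ‖f ω * g ω‖ₑ ∂μ ≤ eLpNorm f 2 ν * ν univ ^ (1 / 2 : ℝ) := by
  have hf := Lp.aestronglyMeasurable f
  calc ∫⁻ ω, ‖f ω * g ω‖ₑ ∂μ = ∫⁻ ω, ((fun ω => ‖g ω‖ₑ) * fun ω => ‖f ω‖ₑ) ω ∂μ := by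
        simp [enorm_mul, mul_comm]
    _ = ∫⁻ ω, ‖f ω‖ₑ ∂(μ.withDensity fun ω => ‖g ω‖ₑ) :=
        (lintegral_withDensity_eq_lintegral_mul₀ hg.enorm.aemeasurable (hf.mono_ac hμ).enorm).symm
    _ ≤ ∫⁻ ω, ‖f ω‖ₑ ∂ν := lintegral_mono' hgν le_rfl
    _ = eLpNorm f 1 ν := eLpNorm_one_eq_lintegral_enorm.symm
    _ ≤ _ := by
        refine (eLpNorm_le_eLpNorm_mul_rpow_measure_univ one_le_two hf).trans_eq ?_
        norm_num

lemma integrable_coeFn_mul {μ ν : Measure Ω} [IsFiniteMeasure ν] {g : Ω → ℝ} (hg : Measurable g)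
    (hμ : μ ≪ ν) (hgν : μ.withDensity (fun ω => ‖g ω‖ₑ) ≤ ν) (f : Lp ℝ 2 ν) :
    Integrable (fun ω => f ω * g ω) μ := by
  refine ⟨((Lp.aestronglyMeasurable f).mono_ac hμ).mul hg.aestronglyMeasurable, ?_⟩
  exact (lintegral_enorm_mul_le hg hμ hgν f).trans_lt
    (ENNReal.mul_lt_top (Lp.eLpNorm_lt_top f)
      (ENNReal.rpow_lt_top_of_nonneg (by norm_num) (measure_ne_top _ _)))

lemma exists_integral_functional {μ ν : Measure Ω} [IsFiniteMeasure ν] {g : Ω → ℝ}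
    (hg : Measurable g) (hμ : μ ≪ ν) (hgν : μ.withDensity (fun ω => ‖g ω‖ₑ) ≤ ν) :
    ∃ L : Lp ℝ 2 ν →L[ℝ] ℝ, ∀ f, L f = ∫ ω, f ω * g ω ∂μ := by
  have hint := integrable_coeFn_mul hg hμ hgν
  let L₀ : Lp ℝ 2 ν →ₗ[ℝ] ℝ :=
    { toFun := fun f => ∫ ω, f ω * g ω ∂μ
      map_add' := fun f f' => by
        rw [← integral_add (hint f) (hint f')]
        refine integral_congr_ae ?_
        filter_upwards [hμ.ae_le (Lp.coeFn_add f f')] with ω h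
        rw [h, Pi.add_apply, add_mul]
      map_smul' := fun c f => by
        rw [RingHom.id_apply, smul_eq_mul, ← integral_const_mul]
        refine integral_congr_ae ?_
        filter_upwards [hμ.ae_le (Lp.coeFn_smul c f)] with ω h
        rw [h, Pi.smul_apply, smul_eq_mul, mul_assoc] }
  refine ⟨L₀.mkContinuous ((ν univ ^ (1 / 2 : ℝ)).toReal) fun f => ?_, fun f => rfl⟩
  have h := (enorm_integral_le_lintegral_enorm _).trans (lintegral_enorm_mul_le hg hμ hgν f)
  have hreal := ENNReal.toReal_mono (ENNReal.mul_ne_top (Lp.eLpNorm_lt_top f).ne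
      (ENNReal.rpow_lt_top_of_nonneg (by norm_num) (measure_ne_top _ _)).ne) h
  rw [ENNReal.toReal_mul, toReal_enorm, mul_comm] at hreal
  exact hreal

/-- Randomized stopping rules at the times `0, …, n` with information `ℱ 0, …, ℱ n`: the `i`-th
coordinate is the probability of stopping at time `i`. -/
def relaxed (ν : Measure Ω) [IsFiniteMeasure ν] {n : ℕ} (ℱ : Fin n → MeasurableSpace Ω) :
    Set (PiLp 2 fun _ : Fin n => Lp ℝ 2 ν) :=
  {ψ | (∀ i, AEStronglyMeasurable[ℱ i] (ψ i) ν) ∧ (∀ i, 0 ≤ ψ i) ∧ ∑ i, ψ i = Lp.const 2 ν (1 : ℝ)}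

variable {ν : Measure Ω} [IsFiniteMeasure ν] {n : ℕ} {ℱ : Fin n → MeasurableSpace Ω}

lemma mem_relaxed_iff {ψ : PiLp 2 fun _ : Fin n => Lp ℝ 2 ν} :
    ψ ∈ relaxed ν ℱ ↔ (∀ i, AEStronglyMeasurable[ℱ i] (ψ i) ν) ∧ (∀ i, ∀ᵐ ω ∂ν, 0 ≤ ψ i ω) ∧
      ∀ᵐ ω ∂ν, ∑ i, ψ i ω = 1 := by
  refine and_congr_right fun _ => and_congr ?_ ?_
  · exact forall_congr' fun i => (Lp.coeFn_nonneg _).symm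
  · have h₁ := Lp.coeFn_finsetSum Finset.univ (fun i => ψ i)
    have h₂ := Lp.coeFn_const (p := 2) (μ := ν) (c := (1 : ℝ))
    rw [Lp.ext_iff]
    constructor
    · intro h
      filter_upwards [h, h₁, h₂] with ω h h₁ h₂
      rw [h₁, h₂] at h
      simpa using h
    · intro h
      filter_upwards [h, h₁, h₂] with ω h h₁ h₂
      rw [h₁, h₂]
      simpa using h

lemma convex_relaxed : Convex ℝ (relaxed ν ℱ) := by
  intro ψ hψ ψ' hψ' a b ha hb hab
  obtain ⟨hm, h0, h1⟩ := mem_relaxed_iff.1 hψ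
  obtain ⟨hm', h0', h1'⟩ := mem_relaxed_iff.1 hψ'
  have key : ∀ i, ∀ᵐ ω ∂ν, (a • ψ + b • ψ') i ω = a * ψ i ω + b * ψ' i ω := fun i => by
    filter_upwards [Lp.coeFn_add (a • ψ i) (b • ψ' i), Lp.coeFn_smul a (ψ i),
      Lp.coeFn_smul b (ψ' i)] with ω e e₁ e₂
    rw [PiLp.add_apply, PiLp.smul_apply, PiLp.smul_apply, e, Pi.add_apply, e₁, e₂]
    rfl
  refine mem_relaxed_iff.2 ⟨fun i => ?_, fun i => ?_, ?_⟩
  · have h : AEStronglyMeasurable[ℱ i] (a • ⇑(ψ i) + b • ⇑(ψ' i)) ν :=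
      ((hm i).const_smul a).add ((hm' i).const_smul b)
    refine h.congr ?_
    filter_upwards [key i] with ω e
    rw [e]
    rfl
  · filter_upwards [key i, h0 i, h0' i] with ω e h h'
    rw [e]
    positivity
  · filter_upwards [ae_all_iff.2 key, h1, h1'] with ω e h h'
    simp only [e, Finset.sum_add_distrib, ← Finset.mul_sum]
    rw [h, h', mul_one, mul_one, hab]

lemma isClosed_relaxed (hℱ : ∀ i, ℱ i ≤ mΩ) : IsClosed (relaxed ν ℱ) := by
  have hc : ∀ i, Continuous fun ψ : PiLp 2 fun _ : Fin n => Lp ℝ 2 ν => ψ i :=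
    fun i => PiLp.continuous_apply 2 _ i
  simp only [relaxed, ofPred_and, ofPred_forall]
  refine IsClosed.inter (isClosed_iInter fun i => ?_) (IsClosed.inter (isClosed_iInter fun i => ?_) ?_)
  · exact (isClosed_aestronglyMeasurable (hℱ i)).preimage (hc i)
  · exact isClosed_le continuous_const (hc i)
  · exact isClosed_eq (continuous_finsetSum _ fun i _ => hc i) continuous_const

lemma le_one_of_sum_eq_one {ι : Type*} [Fintype ι] {f : ι → ℝ} (h0 : ∀ i, 0 ≤ f i)
    (h1 : ∑ i, f i = 1) (i : ι) : f i ≤ 1 :=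
  h1 ▸ Finset.single_le_sum (fun j _ => h0 j) (Finset.mem_univ i)

lemma isBounded_relaxed : Bornology.IsBounded (relaxed ν ℱ) := by
  set M := ‖Lp.const 2 ν (1 : ℝ)‖
  refine isBounded_iff_forall_norm_le.2 ⟨√(∑ _ : Fin n, M ^ 2), fun ψ hψ => ?_⟩
  obtain ⟨-, h0, h1⟩ := mem_relaxed_iff.1 hψ
  refine Real.le_sqrt_of_sq_le ?_
  rw [PiLp.norm_sq_eq_of_L2]
  refine Finset.sum_le_sum fun i _ => pow_le_pow_left₀ (norm_nonneg _) ?_ 2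
  refine Lp.norm_le_norm_of_ae_le ?_
  filter_upwards [ae_all_iff.2 h0, h1, Lp.coeFn_const (p := 2) (μ := ν) (c := (1 : ℝ))] with ω h0 h1 hc
  rw [hc, Function.const_apply, norm_one, Real.norm_of_nonneg (h0 i)]
  exact le_one_of_sum_eq_one h0 h1 i

/-- A set of positive measure of a non-atomic space contains arbitrarily many disjoint sets of
positive measure. -/
lemma IsNonatomicOn.exists_disjoint {P : Measure Ω} [IsFiniteMeasure P] {m : MeasurableSpace Ω}
    (hm : m ≤ mΩ) (h : IsNonatomicOn P m) (N : ℕ) :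
    ∀ A, MeasurableSet[m] A → 0 < P A → ∃ B : Fin N → Set Ω, (∀ k, MeasurableSet[m] (B k)) ∧
      (∀ k, B k ⊆ A) ∧ (∀ k, 0 < P (B k)) ∧ Pairwise (Function.onFun Disjoint B) := by
  induction N with
  | zero => exact fun A _ _ => ⟨fun _ => ∅, by simp, by simp, fun k => k.elim0, fun k => k.elim0⟩
  | succ N ih =>
    intro A hA hPA
    obtain ⟨D, hDA, hD, hPD, hlt⟩ := h A hA hPA
    obtain ⟨B, hB, hBA, hPB, hd⟩ := ih (A \ D) (hA.diff hD) (by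
      rw [measure_sdiff hDA (hm _ hD).nullMeasurableSet (measure_ne_top _ _)]
      exact tsub_pos_of_lt hlt)
    refine ⟨Fin.cons D B, Fin.cases hD hB, Fin.cases hDA fun k => (hBA k).trans sdiff_subset,
      Fin.cases hPD hPB, ?_⟩
    have hDB : ∀ k, Disjoint D (B k) := fun k => disjoint_sdiff_right.mono_right (hBA k)
    intro k l hkl
    induction k using Fin.cases with
    | zero =>
      induction l using Fin.cases with
      | zero => exact absurd rfl hkl
      | succ l => exact hDB l
    | succ k =>
      induction l using Fin.cases with
      | zero => exact (hDB k).symm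
      | succ l => exact hd fun e => hkl (congrArg _ e)

end Relaxed

/-! ### Extreme randomized rules are pure -/

section Relaxed

variable {Ω : Type*} {mΩ : MeasurableSpace Ω} {ν : Measure Ω} [IsFiniteMeasure ν] {n : ℕ}
  {ℱ : Fin n → MeasurableSpace Ω}

/-- Only nonnegativity needs the bound on `|h j|`. The bound is symmetric in the sign, so it also
serves `-h`. -/
lemma add_mem_relaxed {ψ h : PiLp 2 fun _ : Fin n => Lp ℝ 2 ν} (hψ : ψ ∈ relaxed ν ℱ)
    (hm : ∀ j, AEStronglyMeasurable[ℱ j] (h j) ν) (hle : ∀ j, ∀ᵐ ω ∂ν, |h j ω| ≤ ψ j ω)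
    (h0 : ∀ᵐ ω ∂ν, ∑ j, h j ω = 0) : ψ + h ∈ relaxed ν ℱ := by
  obtain ⟨hψm, -, hψ1⟩ := mem_relaxed_iff.1 hψ
  have key : ∀ j, ∀ᵐ ω ∂ν, (ψ + h) j ω = ψ j ω + h j ω := fun j => by
    filter_upwards [Lp.coeFn_add (ψ j) (h j)] with ω e
    exact e
  refine mem_relaxed_iff.2 ⟨fun j => ?_, fun j => ?_, ?_⟩
  · refine ((hψm j).add (hm j)).congr ?_
    filter_upwards [key j] with ω e
    exact e.symm
  · filter_upwards [key j, hle j] with ω e hl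
    rw [e]
    linarith [neg_abs_le (h j ω)]
  · filter_upwards [ae_all_iff.2 key, hψ1, h0] with ω e h1 h2
    simp only [e, Finset.sum_add_distrib]
    rw [h1, h2, add_zero]

/-- The step function with values `c k` on the sets `B k`. -/
noncomputable def stepFun {N : ℕ} (B : Fin N → Set Ω) (c : Fin N → ℝ) (ω : Ω) : ℝ :=
  ∑ k, (B k).indicator (fun _ => c k) ω

lemma stepFun_of_mem {N : ℕ} {B : Fin N → Set Ω} (hd : Pairwise (Function.onFun Disjoint B))
    (c : Fin N → ℝ) {k : Fin N} {ω : Ω} (hω : ω ∈ B k) : stepFun B c ω = c k := by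
  rw [stepFun, Finset.sum_eq_single k, indicator_of_mem hω]
  · intro l _ hlk
    exact indicator_of_notMem (fun hl => disjoint_left.1 (hd hlk) hl hω) _
  · simp

lemma abs_stepFun_le {N : ℕ} {B : Fin N → Set Ω} (hd : Pairwise (Function.onFun Disjoint B))
    (c : Fin N → ℝ) (ω : Ω) : |stepFun B c ω| ≤ ‖c‖ := by
  by_cases h : ∃ k, ω ∈ B k
  · obtain ⟨k, hk⟩ := h
    rw [stepFun_of_mem hd c hk]
    exact norm_le_pi_norm c k
  · push Not at h
    rw [stepFun, Finset.sum_eq_zero fun k _ => indicator_of_notMem (h k) _]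
    simp

lemma stronglyMeasurable_stepFun {m : MeasurableSpace Ω} {N : ℕ} {B : Fin N → Set Ω}
    (hB : ∀ k, MeasurableSet[m] (B k)) (c : Fin N → ℝ) :
    StronglyMeasurable[m] (stepFun B c) :=
  Finset.stronglyMeasurable_fun_sum _ fun k _ => stronglyMeasurable_const.indicator (hB k)

variable {ι : Type*} [Fintype ι]

/-- If a randomized stopping rule can be moved in both directions along `u • d` for all small
`ℱ i`-measurable `u`, then some such move does not change finitely many linear functionals. -/
lemma exists_perturbation (hℱ : ∀ i, ℱ i ≤ mΩ) (hmono : Monotone ℱ) {P : Measure Ω}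
    [IsFiniteMeasure P] (hνP : ν ≪ P) (hPν : P ≪ ν)
    (L : (PiLp 2 fun _ : Fin n => Lp ℝ 2 ν) →L[ℝ] (ι → ℝ))
    {ψ : PiLp 2 fun _ : Fin n => Lp ℝ 2 ν} (hψ : ψ ∈ relaxed ν ℱ) (i : Fin n)
    (hna : IsNonatomicOn P (ℱ i)) (d : Fin n → Ω → ℝ) (hd0 : ∀ j, ¬ i ≤ j → d j = 0)
    (hdm : ∀ j, i ≤ j → StronglyMeasurable[ℱ j] (d j))
    (hdψ : ∀ j, ∀ᵐ ω ∂ν, |d j ω| ≤ ψ j ω) (hsum : ∀ᵐ ω ∂ν, ∑ j, d j ω = 0)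
    {A : Set Ω} (hA : MeasurableSet[ℱ i] A) (hνA : 0 < ν A) (hne : ∀ ω ∈ A, d i ω ≠ 0) :
    ∃ h ≠ 0, L h = 0 ∧ ψ + h ∈ relaxed ν ℱ ∧ ψ - h ∈ relaxed ν ℱ := by
  -- One more piece than there are functionals, so that the linear map from amplitudes to functional
  -- values has a nontrivial kernel.
  obtain ⟨B, hB, hBA, hPB, hdisj⟩ := hna.exists_disjoint (hℱ i) (Fintype.card ι + 1) A hA
    (pos_iff_ne_zero.2 fun h => hνA.ne' (hνP h))
  have hmeas : ∀ c j, StronglyMeasurable[ℱ j] fun ω => stepFun B c ω * d j ω := by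
    intro c j
    by_cases hij : i ≤ j
    · exact ((stronglyMeasurable_stepFun hB c).mono (hmono hij)).mul (hdm j hij)
    · simp only [hd0 j hij, Pi.zero_apply, mul_zero]
      exact stronglyMeasurable_zero
  have hbd : ∀ c j, ∀ᵐ ω ∂ν, |stepFun B c ω * d j ω| ≤ ‖c‖ * ψ j ω := by
    intro c j
    filter_upwards [hdψ j] with ω h
    rw [abs_mul]
    exact mul_le_mul (abs_stepFun_le hdisj c ω) h (abs_nonneg _) (norm_nonneg _)
  have hLp : ∀ c j, MemLp (fun ω => stepFun B c ω * d j ω) 2 ν := by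
    intro c j
    refine (Lp.memLp (ψ j)).of_le_mul (c := ‖c‖) ((hmeas c j).mono (hℱ j)).aestronglyMeasurable ?_
    filter_upwards [hbd c j] with ω h
    exact h.trans (mul_le_mul_of_nonneg_left (le_abs_self _) (norm_nonneg _))
  -- The move with amplitude `c k` on the piece `B k`, linear in the amplitudes.
  let Λ : (Fin (Fintype.card ι + 1) → ℝ) →ₗ[ℝ] PiLp 2 fun _ : Fin n => Lp ℝ 2 ν :=
    { toFun := fun c => WithLp.toLp 2 fun j => (hLp c j).toLp _
      map_add' := fun c c' => by
        ext1 j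
        rw [PiLp.add_apply, PiLp.toLp_apply, PiLp.toLp_apply, PiLp.toLp_apply, ← MemLp.toLp_add]
        refine MemLp.toLp_congr _ _ (ae_of_all _ fun ω => ?_)
        simp only [stepFun, Pi.add_apply, indicator_add, Finset.sum_add_distrib, add_mul]
      map_smul' := fun a c => by
        ext1 j
        rw [PiLp.smul_apply, PiLp.toLp_apply, PiLp.toLp_apply, RingHom.id_apply,
          ← MemLp.toLp_const_smul]
        refine MemLp.toLp_congr _ _ (ae_of_all _ fun ω => ?_)
        simp only [stepFun, Pi.smul_apply, smul_eq_mul, indicator_const_mul, Finset.mul_sum,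
          Finset.sum_mul, mul_assoc] }
  have hΛ : ∀ c j, ∀ᵐ ω ∂ν, Λ c j ω = stepFun B c ω * d j ω := fun c j => (hLp c j).coeFn_toLp
  have hker := LinearMap.ker_ne_bot_of_finrank_lt (f := L.toLinearMap ∘ₗ Λ) (by simp)
  obtain ⟨c₀, hc₀, hc₀ne⟩ := (Submodule.ne_bot_iff _).1 hker
  have hLc₀ : L (Λ c₀) = 0 := hc₀
  -- With sup norm 1 the move stays below `ψ` in absolute value, as `add_mem_relaxed` requires.
  set c := ‖c₀‖⁻¹ • c₀ with hc
  have hcn : ‖c‖ = 1 := by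
    rw [hc, norm_smul, norm_inv, norm_norm, inv_mul_cancel₀ (norm_ne_zero_iff.2 hc₀ne)]
  have hLc : L (Λ c) = 0 := by rw [hc, map_smul, map_smul, hLc₀, smul_zero]
  have hm : ∀ j, AEStronglyMeasurable[ℱ j] (Λ c j) ν := fun j =>
    (hmeas c j).aestronglyMeasurable.congr (by filter_upwards [hΛ c j] with ω e using e.symm)
  have hle : ∀ j, ∀ᵐ ω ∂ν, |Λ c j ω| ≤ ψ j ω := fun j => by
    filter_upwards [hΛ c j, hbd c j] with ω e h
    rwa [e, ← one_mul (ψ j ω), ← hcn]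
  have h0 : ∀ᵐ ω ∂ν, ∑ j, Λ c j ω = 0 := by
    filter_upwards [ae_all_iff.2 (hΛ c), hsum] with ω e h
    simp only [e, ← Finset.mul_sum]
    rw [h, mul_zero]
  have hneg : ∀ j, ∀ᵐ ω ∂ν, (-Λ c) j ω = -Λ c j ω := fun j => Lp.coeFn_neg (Λ c j)
  refine ⟨Λ c, fun hzero => ?_, hLc, add_mem_relaxed hψ hm hle h0, ?_⟩
  · have hc0 : c ≠ 0 := by
      rw [← norm_ne_zero_iff, hcn]
      exact one_ne_zero
    -- On the non-null piece `B k` the `i`-th coordinate of the move is `c k * d i`, and neither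
    -- factor vanishes there.
    obtain ⟨k, hk⟩ := Function.ne_iff.1 hc0
    refine (pos_iff_ne_zero.1 (hPB k)) (hPν (measure_mono_null (fun ω hω => ?_) (ae_iff.1
      (show ∀ᵐ ω ∂ν, stepFun B c ω * d i ω = 0 from ?_))))
    · change ¬ _
      rw [stepFun_of_mem hdisj c hω]
      exact mul_ne_zero hk (hne ω (hBA k hω))
    · filter_upwards [hΛ c i, Lp.coeFn_zero ℝ 2 ν] with ω e e0
      rw [← e, hzero]
      exact e0
  · rw [sub_eq_add_neg]
    refine add_mem_relaxed hψ (fun j => ?_) (fun j => ?_) ?_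
    · refine (hm j).neg.congr ?_
      filter_upwards [hneg j] with ω e using e.symm
    · filter_upwards [hneg j, hle j] with ω e h
      rwa [e, abs_neg]
    · filter_upwards [ae_all_iff.2 hneg, h0] with ω e h
      simp only [e, Finset.sum_neg_distrib]
      rw [h, neg_zero]

/-- An extreme point of a fibre of `L` in the set of randomized stopping rules is not randomized. -/
lemma ae_zero_or_one_of_extreme (hℱ : ∀ i, ℱ i ≤ mΩ) (hmono : Monotone ℱ) {P : Measure Ω}
    [IsFiniteMeasure P] (hνP : ν ≪ P) (hPν : P ≪ ν)
    (L : (PiLp 2 fun _ : Fin n => Lp ℝ 2 ν) →L[ℝ] (ι → ℝ)) (hna : ∀ i, IsNonatomicOn P (ℱ i))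
    {ψ : PiLp 2 fun _ : Fin n => Lp ℝ 2 ν} (hψ : ψ ∈ relaxed ν ℱ)
    (hext : ∀ h, ψ + h ∈ relaxed ν ℱ → ψ - h ∈ relaxed ν ℱ → L h = 0 → h = 0) (i : Fin n) :
    ∀ᵐ ω ∂ν, ψ i ω = 0 ∨ ψ i ω = 1 := by
  obtain ⟨hψm, hψ0, hψ1⟩ := mem_relaxed_iff.1 hψ
  choose g hgm hg using hψm
  have hψ0' := ae_all_iff.2 hψ0
  have hg' := ae_all_iff.2 hg
  induction i using WellFoundedLT.induction with
  | ind i ih =>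
  -- Stated with the `ℱ i`-measurable version `g i`, so that `A` is known at time `i`.
  set A := {ω | 0 < g i ω ∧ g i ω < 1}
  have hA : MeasurableSet[ℱ i] A :=
    (measurableSet_lt measurable_const (hgm i).measurable).inter
      (measurableSet_lt (hgm i).measurable measurable_const)
  by_cases hνA : ν A = 0
  · filter_upwards [measure_eq_zero_iff_ae_notMem.1 hνA, hψ0', hψ1, hg i] with ω hω h0 h1 e
    by_contra! hne
    refine hω ⟨?_, ?_⟩
    · rw [← e]
      exact (h0 i).lt_of_ne' hne.1
    · rw [← e]
      exact (le_one_of_sum_eq_one h0 h1 i).lt_of_ne hne.2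
  exfalso
  have ih' : ∀ᵐ ω ∂ν, ∀ j, j < i → ψ j ω = 0 ∨ ψ j ω = 1 := by
    refine ae_all_iff.2 fun j => ?_
    by_cases hj : j < i
    · filter_upwards [ih j hj] with ω h _ using h
    · exact ae_of_all _ fun ω h => absurd h hj
  -- Mass is added at time `i` and taken from each other time in proportion to its share `g j / (1 -
  -- g i)` of the rest, so the total change is zero. The factor `min (g i) (1 - g i)` keeps every
  -- change below `g j` in absolute value.
  let w : Fin n → Ω → ℝ := fun j ω =>
    min (g i ω) (1 - g i ω) * if j = i then 1 else -(g j ω / (1 - g i ω))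
  -- Times before `i` are cut off because `w j` need not be `ℱ j`-measurable there. Almost surely
  -- nothing is lost, as the earlier coordinates vanish on `A`.
  let d : Fin n → Ω → ℝ := fun j => if i ≤ j then A.indicator (w j) else 0
  -- By induction an earlier coordinate is 0 or 1; the value 1 would leave no mass for `g i > 0`.
  have hlow : ∀ᵐ ω ∂ν, ω ∈ A → ∀ j, j < i → g j ω = 0 := by
    filter_upwards [ih', hψ0', hψ1, hg'] with ω hω h0 h1 e hωA j hj
    rw [← e]
    refine (hω j hj).resolve_right fun hone => ?_
    have := Finset.add_le_sum (f := fun j => ψ j ω) (fun k _ => h0 k) (Finset.mem_univ j)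
      (Finset.mem_univ i) hj.ne
    rw [h1, hone, e] at this
    linarith [hωA.1]
  have hd : ∀ᵐ ω ∂ν, ∀ j, d j ω = A.indicator (w j) ω := by
    filter_upwards [hlow] with ω hω j
    by_cases hij : i ≤ j
    · simp [d, hij]
    · by_cases hωA : ω ∈ A
      · have hji : j ≠ i := fun h => hij h.ge
        simp [d, hij, hωA, w, hji, hω hωA j (not_le.1 hij)]
      · simp [d, hij, hωA]
  suffices H : ∃ h ≠ 0, L h = 0 ∧ ψ + h ∈ relaxed ν ℱ ∧ ψ - h ∈ relaxed ν ℱ by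
    obtain ⟨h, hh, hLh, h₁, h₂⟩ := H
    exact hh (hext h h₁ h₂ hLh)
  refine exists_perturbation hℱ hmono hνP hPν L hψ i (hna i) d
    (fun j hj => by simp [d, hj]) (fun j hj => ?_) (fun j => ?_) ?_ hA (pos_iff_ne_zero.2 hνA)
    (fun ω hω => ?_)
  · have hgi := (hgm i).mono (hmono hj)
    simp only [d, hj, if_true]
    refine StronglyMeasurable.indicator ?_ (hmono hj _ hA)
    have hmin : StronglyMeasurable[ℱ j] fun ω => min (g i ω) (1 - g i ω) :=
      (hgi.measurable.min (hgi.measurable.const_sub 1)).stronglyMeasurable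
    refine StronglyMeasurable.mul hmin ?_
    by_cases hji : j = i
    · simp only [hji, if_true]
      exact stronglyMeasurable_const
    · simp only [hji, if_false]
      exact ((hgm j).measurable.div (hgi.measurable.const_sub 1)).neg.stronglyMeasurable
  · filter_upwards [hd, hg', hψ0'] with ω hω e h0
    rw [hω j]
    by_cases hωA : ω ∈ A
    · have h1 : 0 < 1 - g i ω := sub_pos.2 hωA.2
      have hm0 : 0 ≤ min (g i ω) (1 - g i ω) := le_min hωA.1.le h1.le
      have hgj : 0 ≤ g j ω := by
        rw [← e]
        exact h0 j
      rw [indicator_of_mem hωA, e]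
      simp only [w, abs_mul, abs_of_nonneg hm0]
      by_cases hji : j = i
      · simp [hji]
      · simp only [hji, if_false, abs_neg, abs_of_nonneg (div_nonneg hgj h1.le)]
        calc _ ≤ (1 - g i ω) * (g j ω / (1 - g i ω)) :=
              mul_le_mul_of_nonneg_right (min_le_right _ _) (div_nonneg hgj h1.le)
          _ = g j ω := mul_div_cancel₀ _ h1.ne'
    · rw [indicator_of_notMem hωA, abs_zero]
      exact h0 j
  · filter_upwards [hd, hg', hψ1] with ω hω e h1
    simp only [hω]
    by_cases hωA : ω ∈ A
    · simp only [indicator_of_mem hωA, w, ← Finset.mul_sum]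
      have h1' : 1 - g i ω ≠ 0 := (sub_pos.2 hωA.2).ne'
      have hrw : ∀ j, (if j = i then (1 : ℝ) else -(g j ω / (1 - g i ω))) =
          (if j = i then 1 + g i ω / (1 - g i ω) else 0) - g j ω / (1 - g i ω) := by
        intro j
        split_ifs with hji
        · rw [hji]
          ring
        · ring
      simp only [e] at h1
      simp only [hrw, Finset.sum_sub_distrib, ← Finset.sum_div, h1]
      simp only [Finset.sum_ite_eq', Finset.mem_univ, if_true]
      field_simp
      ring
    · simp [indicator_of_notMem hωA]
  · simp only [d, le_refl, if_true, indicator_of_mem hω, w, mul_one]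
    exact (lt_min hω.1 (sub_pos.2 hω.2)).ne'

end Relaxed

/-! ### The attainable vectors of expectations -/

section Attainable

variable {Ω : Type*} {mΩ : MeasurableSpace Ω} {n : ℕ} {S : Type*}

/-- The expectations under the measures `μ θ` of the processes `y` stopped at an index `ρ` with
`{ρ = i} ∈ ℱ i`. -/
def attainable {n : ℕ} (μ : S → Measure Ω) (ℱ : Fin n → MeasurableSpace Ω)
    (y : Fin n → Ω → ℝ) : Set (S → ℝ) :=
  {x | ∃ ρ : Ω → Fin n, (∀ i, MeasurableSet[ℱ i] (ρ ⁻¹' {i})) ∧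
    ∀ θ, x θ = ∫ ω, y (ρ ω) ω ∂(μ θ)}

lemma integral_stopped_eq_sum {μ : Measure Ω} {y : Fin n → Ω → ℝ}
    (hyi : ∀ i, Integrable (y i) μ) {ρ : Ω → Fin n} (hρ : ∀ i, MeasurableSet (ρ ⁻¹' {i})) :
    Integrable (fun ω => y (ρ ω) ω) μ ∧
    ∫ ω, y (ρ ω) ω ∂μ = ∑ i, ∫ ω, (ρ ⁻¹' {i}).indicator 1 ω * y i ω ∂μ := by
  have hint : ∀ i, Integrable (fun ω => (ρ ⁻¹' {i}).indicator 1 ω * y i ω) μ := fun i => by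
    refine ((hyi i).indicator (hρ i)).congr (ae_of_all _ fun ω => ?_)
    by_cases h : ω ∈ ρ ⁻¹' {i}
    · simp only [indicator_of_mem h, Pi.one_apply, one_mul]
    · simp only [indicator_of_notMem h, zero_mul]
  have heq : (fun ω => y (ρ ω) ω) = fun ω => ∑ i, (ρ ⁻¹' {i}).indicator 1 ω * y i ω := by
    funext ω
    rw [Finset.sum_eq_single (ρ ω)]
    · simp
    · intro i _ hi
      simp [hi.symm]
    · simp
  rw [heq]
  exact ⟨integrable_finsetSum _ fun i _ => hint i, integral_finsetSum _ fun i _ => hint i⟩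

variable [Fintype S] (μ : S → Measure Ω) (y : Fin n → Ω → ℝ) (P : Measure Ω)

/-- A measure which dominates `P`, all `μ θ`, and all `|y i| dμ θ`. -/
noncomputable def dominating : Measure Ω :=
  P + ∑ θ, μ θ + ∑ θ, ∑ i, (μ θ).withDensity fun ω => ‖y i ω‖ₑ

lemma le_dominating : P ≤ dominating μ y P := by
  rw [dominating, add_assoc]
  exact Measure.le_add_right le_rfl

lemma le_dominating_of_scenario (θ : S) : μ θ ≤ dominating μ y P :=
  Measure.le_add_right (Measure.le_add_left
    (Finset.single_le_sum (f := μ) (fun _ _ => Measure.zero_le _) (Finset.mem_univ θ)))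

lemma withDensity_le_dominating (θ : S) (i : Fin n) :
    (μ θ).withDensity (fun ω => ‖y i ω‖ₑ) ≤ dominating μ y P :=
  Measure.le_add_left
    ((Finset.single_le_sum (f := fun i => (μ θ).withDensity fun ω => ‖y i ω‖ₑ)
      (fun _ _ => Measure.zero_le _) (Finset.mem_univ i)).trans
    (Finset.single_le_sum (f := fun θ => ∑ i, (μ θ).withDensity fun ω => ‖y i ω‖ₑ)
      (fun _ _ => Measure.zero_le _) (Finset.mem_univ θ)))

variable {μ y P}

/-- With `le_dominating` this gives the same null sets as `P`, so non-atomicity under `P` can be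
used for rules defined up to `dominating`-null sets. -/
lemma dominating_absolutelyContinuous (hμ : ∀ θ, μ θ ≪ P) : dominating μ y P ≪ P := by
  intro s hs
  simp only [dominating, Measure.coe_add, Measure.coe_finsetSum, Pi.add_apply, Finset.sum_apply]
  rw [hs, Finset.sum_eq_zero fun θ _ => hμ θ hs, Finset.sum_eq_zero fun θ _ =>
    Finset.sum_eq_zero fun i _ => withDensity_absolutelyContinuous _ _ (hμ θ hs)]
  simp

lemma isFiniteMeasure_dominating [IsFiniteMeasure P] [∀ θ, IsFiniteMeasure (μ θ)]
    (hyi : ∀ θ i, Integrable (y i) (μ θ)) : IsFiniteMeasure (dominating μ y P) := by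
  refine ⟨?_⟩
  simp only [dominating, Measure.coe_add, Measure.coe_finsetSum, Pi.add_apply, Finset.sum_apply,
    withDensity_apply _ MeasurableSet.univ, Measure.restrict_univ, ENNReal.add_lt_top,
    ENNReal.sum_lt_top]
  exact ⟨⟨measure_lt_top _ _, fun _ _ => measure_lt_top _ _⟩, fun θ _ i _ => (hyi θ i).2⟩

/-- A randomized stopping rule with values `0` and `1` is a stopping index. -/
lemma exists_index_of_zero_or_one {ν : Measure Ω} [IsFiniteMeasure ν] {n : ℕ}
    {ℱ : Fin (n + 1) → MeasurableSpace Ω} (hmono : Monotone ℱ)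
    {ψ : PiLp 2 fun _ : Fin (n + 1) => Lp ℝ 2 ν} (hψ : ψ ∈ relaxed ν ℱ)
    (h01 : ∀ i, ∀ᵐ ω ∂ν, ψ i ω = 0 ∨ ψ i ω = 1) :
    ∃ ρ : Ω → Fin (n + 1), (∀ i, MeasurableSet[ℱ i] (ρ ⁻¹' {i})) ∧
      ∀ i, ∀ᵐ ω ∂ν, ψ i ω = (ρ ⁻¹' {i}).indicator 1 ω := by
  classical
  obtain ⟨hψm, hψ0, hψ1⟩ := mem_relaxed_iff.1 hψ
  choose g hgm hg using hψm
  -- Stop at the first `i` with `g i = 1`. The last index is a default that makes the rule total on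
  -- the exceptional null set.
  let p : Ω → Fin (n + 1) → Prop := fun ω i => g i ω = 1 ∨ i = Fin.last n
  have hp : ∀ ω, ∃ i, p ω i := fun ω => ⟨Fin.last n, .inr rfl⟩
  have hpm : ∀ i, MeasurableSet[ℱ i] {ω | p ω i} := fun i =>
    ((hgm i).measurable (measurableSet_singleton 1)).union (MeasurableSet.const _)
  have hex : ∀ ω, ∃ i, p ω i ∧ ∀ j < i, ¬ p ω j := fun ω => by
    obtain ⟨i, hi, hmin⟩ := WellFounded.has_min (wellFounded_lt (α := Fin (n + 1))) _ (hp ω)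
    exact ⟨i, hi, fun j hj hpj => hmin j hpj hj⟩
  choose ρ hρ hρmin using hex
  have hiff : ∀ ω i, ρ ω = i ↔ p ω i ∧ ∀ j < i, ¬ p ω j := fun ω i => by
    refine ⟨fun h => h ▸ ⟨hρ ω, hρmin ω⟩, fun ⟨h, h'⟩ => ?_⟩
    rcases lt_trichotomy (ρ ω) i with hlt | heq | hgt
    · exact absurd (hρ ω) (h' _ hlt)
    · exact heq
    · exact absurd h (hρmin ω _ hgt)
  refine ⟨ρ, fun i => ?_, fun i => ?_⟩
  · have : ρ ⁻¹' {i} = {ω | p ω i} ∩ ⋂ j, ⋂ (_ : j < i), {ω | p ω j}ᶜ := by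
      ext ω
      simp [hiff]
    rw [this]
    exact (hpm i).inter (MeasurableSet.iInter fun j => MeasurableSet.iInter fun hj =>
      (hmono hj.le _ (hpm j)).compl)
  · filter_upwards [ae_all_iff.2 hg, ae_all_iff.2 hψ0, hψ1, ae_all_iff.2 h01] with ω e h0 h1 h01
    obtain ⟨k, hk⟩ : ∃ k, ψ k ω = 1 := by
      by_contra! hne
      have : ∑ k, ψ k ω = 0 := Finset.sum_eq_zero fun k _ => (h01 k).resolve_right (hne k)
      linarith
    have hother : ∀ j, j ≠ k → ψ j ω = 0 := by
      intro j hj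
      have := Finset.add_le_sum (f := fun j => ψ j ω) (fun l _ => h0 l) (Finset.mem_univ j)
        (Finset.mem_univ k) hj
      rw [h1, hk] at this
      linarith [h0 j]
    have hρk : ρ ω = k := by
      refine (hiff ω k).2 ⟨.inl (by rw [← e, hk]), fun j hj hpj => ?_⟩
      rcases hpj with hpj | hpj
      · rw [← e, hother j hj.ne] at hpj
        exact zero_ne_one hpj
      · exact absurd (Fin.le_last k) (not_le.2 (hpj ▸ hj))
    by_cases hik : i = k
    · rw [hik, hk, indicator_of_mem (show ω ∈ ρ ⁻¹' {k} from hρk), Pi.one_apply]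
    · have hω : ω ∉ ρ ⁻¹' {i} := fun h => hik ((show ρ ω = i from h).symm.trans hρk)
      rw [hother i hik, indicator_of_notMem hω]

/-- The attainable set is compact and convex: randomization does not enlarge it. -/
theorem isCompact_convex_attainable {n : ℕ} {y : Fin (n + 1) → Ω → ℝ}
    {ℱ : Fin (n + 1) → MeasurableSpace Ω} (hℱ : ∀ i, ℱ i ≤ mΩ) (hmono : Monotone ℱ)
    [IsFiniteMeasure P] [∀ θ, IsFiniteMeasure (μ θ)] (hμ : ∀ θ, μ θ ≪ P)
    (hna : ∀ i, IsNonatomicOn P (ℱ i)) (hy : ∀ i, Measurable (y i))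
    (hyi : ∀ θ i, Integrable (y i) (μ θ)) :
    IsCompact (attainable μ ℱ y) ∧ Convex ℝ (attainable μ ℱ y) := by
  set ν := dominating μ y P
  have : IsFiniteMeasure ν := isFiniteMeasure_dominating hyi
  have hμν : ∀ θ, μ θ ≪ ν := fun θ => (le_dominating_of_scenario μ y P θ).absolutelyContinuous
  choose ℓ hℓ using fun θ i =>
    exists_integral_functional (hy i) (hμν θ) (withDensity_le_dominating μ y P θ i)
  let L : (PiLp 2 fun _ : Fin (n + 1) => Lp ℝ 2 ν) →L[ℝ] (S → ℝ) :=
    ContinuousLinearMap.pi fun θ => ∑ i, (ℓ θ i).comp (PiLp.proj 2 _ i)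
  have hL : ∀ (ψ : PiLp 2 fun _ : Fin (n + 1) => Lp ℝ 2 ν) (ρ : Ω → Fin (n + 1)),
      (∀ i, MeasurableSet[ℱ i] (ρ ⁻¹' {i})) →
      (∀ i, ∀ᵐ ω ∂ν, ψ i ω = (ρ ⁻¹' {i}).indicator 1 ω) →
      ∀ θ, L ψ θ = ∫ ω, y (ρ ω) ω ∂(μ θ) := by
    intro ψ ρ hρ hψ θ
    rw [(integral_stopped_eq_sum (hyi θ) fun i => hℱ i _ (hρ i)).2]
    simp only [L, ContinuousLinearMap.coe_pi', sum_apply,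
      ContinuousLinearMap.comp_apply, PiLp.proj_apply, hℓ]
    refine Finset.sum_congr rfl fun i _ => integral_congr_ae ?_
    filter_upwards [(hμν θ).ae_le (hψ i)] with ω h
    rw [h]
  have heq : attainable μ ℱ y = L '' relaxed ν ℱ := by
    apply Subset.antisymm
    · rintro x ⟨ρ, hρ, hx⟩
      have hLp : ∀ i, MemLp ((ρ ⁻¹' {i}).indicator (1 : Ω → ℝ)) 2 ν := fun i =>
        (memLp_const (1 : ℝ)).indicator (hℱ i _ (hρ i))
      have hψ : ∀ i, ∀ᵐ ω ∂ν, (WithLp.toLp 2 fun i => (hLp i).toLp _ :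
          PiLp 2 fun _ : Fin (n + 1) => Lp ℝ 2 ν) i ω = (ρ ⁻¹' {i}).indicator 1 ω :=
        fun i => (hLp i).coeFn_toLp
      refine ⟨_, mem_relaxed_iff.2 ⟨fun i => ?_, fun i => ?_, ?_⟩,
        funext fun θ => (hL _ ρ hρ hψ θ).trans (hx θ).symm⟩
      · exact (stronglyMeasurable_one.indicator (hρ i)).aestronglyMeasurable.congr
          (by filter_upwards [hψ i] with ω h using h.symm)
      · filter_upwards [hψ i] with ω h
        rw [h]
        exact indicator_nonneg (fun _ _ => zero_le_one) ω
      · filter_upwards [ae_all_iff.2 hψ] with ω h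
        simp only [h]
        rw [Finset.sum_eq_single (ρ ω)]
        · simp
        · intro i _ hi
          simp [hi.symm]
        · simp
    · rintro _ ⟨φ, hφ, rfl⟩
      -- The randomized rule is replaced by an extreme rule with the same expectations, which is a
      -- genuine stopping index.
      obtain ⟨ψ, hψ, hLψ, hext⟩ := exists_extremePoint_fiber convex_relaxed (isClosed_relaxed hℱ)
        isBounded_relaxed L hφ
      obtain ⟨ρ, hρ, hψρ⟩ := exists_index_of_zero_or_one hmono hψ
        (ae_zero_or_one_of_extreme hℱ hmono (dominating_absolutelyContinuous hμ)
          (le_dominating μ y P).absolutelyContinuous L hna hψ hext)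
      exact ⟨ρ, hρ, fun θ => hLψ ▸ hL ψ ρ hρ hψρ θ⟩
  rw [heq]
  exact ⟨isCompact_image_of_convex convex_relaxed (isClosed_relaxed hℱ) isBounded_relaxed L,
    convex_relaxed.linear_image L.toLinearMap⟩

end Attainable

/-! ### Semicontinuity, quasi-convexity and Sion's theorem -/

section Minimax

variable {S : Type*} [Fintype S] [TopologicalSpace S] [DiscreteTopology S]
  [MeasurableSpace S] [BorelSpace S] {v : ℝ → EReal} {P₀ : ProbabilityMeasure S}

/-- Left-continuity leaves room for a level `s` strictly below `∫ x dQ` at which `sup_{s' < s} R(Q,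
s')` still exceeds `c`. Property (iv) carries this to nearby `Q'`, whose integrals stay above `s`,
and monotonicity concludes. -/
lemma lowerSemicontinuous_drapeauKupper_integral (x : S → ℝ)
    (hx : ∀ Q : ProbabilityMeasure S,
      ContinuousAt (drapeauKupper v P₀ Q) (∫ θ, x θ ∂(Q : Measure S))) :
    LowerSemicontinuous fun Q : ProbabilityMeasure S =>
      drapeauKupper v P₀ Q (∫ θ, x θ ∂(Q : Measure S)) := by
  intro Q c hc
  obtain ⟨s', hs', hcs'⟩ : ∃ s' < ∫ θ, x θ ∂(Q : Measure S), c < drapeauKupper v P₀ Q s' := by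
    have h : ∀ᶠ s' in 𝓝[<] (∫ θ, x θ ∂(Q : Measure S)), c < drapeauKupper v P₀ Q s' :=
      ((hx Q).eventually_const_lt hc).filter_mono nhdsWithin_le_nhds
    obtain ⟨s', h₁, h₂⟩ := (h.and self_mem_nhdsWithin).exists
    exact ⟨s', h₂, h₁⟩
  obtain ⟨s, hs's, hs⟩ := exists_between hs'
  filter_upwards [drapeauKupper_lsc (v := v) (P₀ := P₀) s Q c (lt_iSup_iff.2 ⟨⟨s', hs's⟩, hcs'⟩),
    (continuous_expect x).continuousAt.eventually_const_lt hs] with Q' h₁ h₂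
  obtain ⟨⟨s'', hs''⟩, h⟩ := lt_iSup_iff.1 h₁
  exact h.trans_le (drapeauKupper_mono Q' ((show s'' < s from hs'').le.trans h₂.le))

/-- The infimum over `s' > s` in the definition yields a bound valid on all of `(-∞, s')`, a
neighbourhood of `s`. -/
lemma upperSemicontinuous_drapeauKupper (Q : ProbabilityMeasure S) :
    UpperSemicontinuous (drapeauKupper v P₀ Q) := by
  intro s c hc
  obtain ⟨s', hs', c', hc', h⟩ := exists_of_drapeauKupper_lt hc
  filter_upwards [Iio_mem_nhds hs'] with r hr
  exact (drapeauKupper_le hr h).trans_lt hc'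

lemma continuous_integral_left (Q : ProbabilityMeasure S) :
    Continuous fun x : S → ℝ => ∫ θ, x θ ∂(Q : Measure S) := by
  simp only [integral_eq_sum]
  fun_prop

lemma upperSemicontinuous_drapeauKupper_integral (Q : ProbabilityMeasure S) :
    UpperSemicontinuous fun x : S → ℝ => drapeauKupper v P₀ Q (∫ θ, x θ ∂(Q : Measure S)) :=
  (upperSemicontinuous_drapeauKupper Q).comp (continuous_integral_left Q)

/-- A nondecreasing function of a linear form is quasi-concave. -/
lemma quasiconcaveOn_drapeauKupper_integral {K : Set (S → ℝ)} (hK : Convex ℝ K)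
    (Q : ProbabilityMeasure S) :
    QuasiconcaveOn ℝ K fun x => drapeauKupper v P₀ Q (∫ θ, x θ ∂(Q : Measure S)) := by
  intro r x hx x' hx' a b ha hb hab
  refine ⟨hK hx.1 hx'.1 ha hb hab, ?_⟩
  have heq : ∫ θ, (a • x + b • x') θ ∂(Q : Measure S) =
      a * ∫ θ, x θ ∂(Q : Measure S) + b * ∫ θ, x' θ ∂(Q : Measure S) := by
    simp only [integral_eq_sum, Finset.mul_sum, ← Finset.sum_add_distrib]
    refine Finset.sum_congr rfl fun θ _ => ?_
    simp only [Pi.add_apply, Pi.smul_apply, smul_eq_mul]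
    ring
  change r ≤ drapeauKupper v P₀ Q (∫ θ, (a • x + b • x') θ ∂(Q : Measure S))
  rw [heq]
  obtain h | h := le_total (∫ θ, x θ ∂(Q : Measure S)) (∫ θ, x' θ ∂(Q : Measure S))
  · refine hx.2.trans (drapeauKupper_mono Q ?_)
    calc _ = a * ∫ θ, x θ ∂(Q : Measure S) + b * ∫ θ, x θ ∂(Q : Measure S) := by
          rw [← add_mul, hab, one_mul]
      _ ≤ _ := by gcongr
  · refine hx'.2.trans (drapeauKupper_mono Q ?_)
    calc _ = a * ∫ θ, x' θ ∂(Q : Measure S) + b * ∫ θ, x' θ ∂(Q : Measure S) := by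
          rw [← add_mul, hab, one_mul]
      _ ≤ _ := by gcongr

/-- Minimax for `(Q, x) ↦ R(Q, ∫ x dQ)` on a compact convex set of functions. -/
theorem exists_saddlePoint_drapeauKupper {K : Set (S → ℝ)} (hKc : IsCompact K)
    (hK : Convex ℝ K) (hKne : K.Nonempty)
    (hcont : ∀ x ∈ K, ∀ Q : ProbabilityMeasure S,
      ContinuousAt (drapeauKupper v P₀ Q) (∫ θ, x θ ∂(Q : Measure S))) :
    ∃ Q₁ : ProbabilityMeasure S, ∃ x₁ ∈ K, ∀ Q : ProbabilityMeasure S, ∀ x ∈ K,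
      drapeauKupper v P₀ Q₁ (∫ θ, x θ ∂(Q₁ : Measure S)) ≤
        drapeauKupper v P₀ Q (∫ θ, x₁ θ ∂(Q : Measure S)) := by
  classical
  -- Sion's theorem is used in the vector space `S → ℝ`; the value `P₀` off the simplex is a dummy.
  let W : (S → ℝ) → ProbabilityMeasure S := fun q =>
    if h : q ∈ stdSimplex ℝ S then ofWeights ⟨q, h⟩ else P₀
  have hW : ∀ q (h : q ∈ stdSimplex ℝ S), W q = ofWeights ⟨q, h⟩ := fun q h => dif_pos h
  obtain ⟨q₁, -, x₁, hx₁, h⟩ := Sion.exists_saddlePointOn' (X := stdSimplex ℝ S) (Y := K)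
    (f := fun q x => drapeauKupper v P₀ (W q) (∫ θ, x θ ∂(W q : Measure S)))
    ⟨_, (weights P₀).2⟩ (convex_stdSimplex ℝ S) (isCompact_stdSimplex ℝ S)
    (fun x hx => by
      rw [← lowerSemicontinuous_restrict_iff]
      have := (lowerSemicontinuous_drapeauKupper_integral x (hcont x hx)).comp
        (continuous_ofWeights (S := S))
      refine (congrArg LowerSemicontinuous (funext fun q => ?_)).mpr this
      simp only [domRestrict_apply, hW q.1 q.2, Function.comp_apply])
    (fun x hx r q hq q' hq' a b ha hb hab => by
      have hmem := convex_stdSimplex ℝ S hq.1 hq'.1 ha hb hab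
      refine ⟨hmem, ?_⟩
      lift a to NNReal using ha
      lift b to NNReal using hb
      have h₁ := hq.2
      have h₂ := hq'.2
      simp only [hW _ hq.1] at h₁
      simp only [hW _ hq'.1] at h₂
      have hcomb := ofWeights_convex_comb (q := ⟨q, hq.1⟩) (q' := ⟨q', hq'.1⟩)
        (q'' := ⟨_, hmem⟩) (a := a) (b := b) rfl
      change drapeauKupper v P₀ (W _) (∫ θ, x θ ∂(W _ : Measure S)) ≤ r
      rw [hW _ hmem, expect_convex_comb hcomb]
      exact (drapeauKupper_quasiconvex (by exact_mod_cast hab) hcomb _ _).trans (max_le h₁ h₂))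
    hK hKne hKc
    (fun q _ => (upperSemicontinuous_drapeauKupper_integral (W q)).upperSemicontinuousOn _)
    (fun q _ => quasiconcaveOn_drapeauKupper_integral hK (W q))
  refine ⟨W q₁, x₁, hx₁, fun Q x hx => ?_⟩
  have := h _ (weights Q).2 x hx
  simp only at this
  rwa [hW _ (weights Q).2, show (⟨(weights Q).1, (weights Q).2⟩ : stdSimplex ℝ S) = weights Q from rfl,
    ofWeights_weights] at this

lemma exists_min_drapeauKupper_integral {x : S → ℝ}
    (hx : ∀ Q : ProbabilityMeasure S,
      ContinuousAt (drapeauKupper v P₀ Q) (∫ θ, x θ ∂(Q : Measure S))) :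
    ∃ Q₁ : ProbabilityMeasure S, ∀ Q : ProbabilityMeasure S,
      drapeauKupper v P₀ Q₁ (∫ θ, x θ ∂(Q₁ : Measure S)) ≤
        drapeauKupper v P₀ Q (∫ θ, x θ ∂(Q : Measure S)) := by
  obtain ⟨q, -, hq⟩ := (((lowerSemicontinuous_drapeauKupper_integral x hx).comp
    (continuous_ofWeights (S := S))).lowerSemicontinuousOn univ).exists_isMinOn
      ⟨weights P₀, mem_univ _⟩ isCompact_univ
  refine ⟨ofWeights q, fun Q => ?_⟩
  have := hq (mem_univ (weights Q))
  simpa only [mem_ofPred_eq, Function.comp_apply, ofWeights_weights] using this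

end Minimax

/-! ### Grid stopping times as indices, and the mixture integral -/

section Game

variable {Ω : Type*} {mΩ : MeasurableSpace Ω} {T : ℝ} {𝔽 : Filtration (Icc (0 : ℝ) T) mΩ}
  {n : ℕ} {t : Fin (n + 1) → Icc (0 : ℝ) T}

/-- Injectivity of `t` identifies `{ρ = i}` with `{τ = t i}`. -/
lemma exists_index_of_mem_gridStoppingTimes (ht : StrictMono t) {τ : Ω → Icc (0 : ℝ) T}
    (hτ : τ ∈ gridStoppingTimes 𝔽 t) :
    ∃ ρ : Ω → Fin (n + 1), (∀ i, MeasurableSet[𝔽 (t i)] (ρ ⁻¹' {i})) ∧ τ = fun ω => t (ρ ω) := by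
  choose ρ hρ using hτ.2
  refine ⟨ρ, fun i => ?_, funext fun ω => (hρ ω).symm⟩
  have h : MeasurableSet[𝔽 (t i)] {ω | (τ ω : WithTop (Icc (0 : ℝ) T)) = t i} :=
    IsStoppingTime.measurableSet_eq hτ.1 (t i)
  convert h using 1
  ext ω
  simp only [mem_preimage, mem_singleton_iff, mem_ofPred_eq, WithTop.coe_inj, ← hρ ω,
    ht.injective.eq_iff]

lemma mem_gridStoppingTimes_of_index {ρ : Ω → Fin (n + 1)}
    (hρ : ∀ i, MeasurableSet[𝔽 (t i)] (ρ ⁻¹' {i})) :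
    (fun ω => t (ρ ω)) ∈ gridStoppingTimes 𝔽 t := by
  refine ⟨fun s => ?_, fun ω => mem_range_self _⟩
  have : {ω | ((t (ρ ω) : Icc (0 : ℝ) T) : WithTop (Icc (0 : ℝ) T)) ≤ s} =
      ⋃ i, ⋃ (_ : t i ≤ s), ρ ⁻¹' {i} := by
    ext ω
    simp
  rw [this]
  exact MeasurableSet.iUnion fun i => MeasurableSet.iUnion fun hi => 𝔽.mono hi _ (hρ i)

variable {S : Type*} [Fintype S] [TopologicalSpace S] [DiscreteTopology S]
  [MeasurableSpace S] [BorelSpace S]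

lemma integral_mixture {κ : Kernel S Ω} [IsMarkovKernel κ] (Q : ProbabilityMeasure S) {f : Ω → ℝ}
    (hf : Measurable f) (hfi : ∀ θ, Integrable f (κ θ)) :
    ∫ x, f x.2 ∂(mixture κ Q) = ∫ θ, ∫ ω, f ω ∂(κ θ) ∂(Q : Measure S) := by
  refine Measure.integral_compProd ((Measure.integrable_compProd_iff
    (hf.comp measurable_snd).aestronglyMeasurable).2 ⟨ae_of_all _ fun θ => hfi θ, .of_finite⟩)

end Game

end AmbiguityStopping

/-! ### The saddle point of the stopping game -/

open AmbiguityStopping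
theorem theorem1
    {S : Type*} [Fintype S] [TopologicalSpace S] [DiscreteTopology S]
    [MeasurableSpace S] [BorelSpace S]
    {Ω : Type*} {mΩ : MeasurableSpace Ω} (P : Measure Ω) [IsProbabilityMeasure P]
    {T : ℝ} (𝔽 : Filtration (Icc (0 : ℝ) T) mΩ) (h𝔽 : UsualConditions 𝔽 P)
    (Y : Icc (0 : ℝ) T → Ω → ℝ) (hY : Adapted 𝔽 Y)
    (hYc : ∀ ω t, ContinuousWithinAt (fun s => Y s ω) (Ici t) t)
    (κ : Kernel S Ω) [IsMarkovKernel κ] (hκ : ∀ θ, κ θ ≪ P)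
    (hYint : ∃ C : NNReal, ∀ θ, ∫⁻ ω, ⨆ t, ENNReal.ofReal |Y t ω| ∂(κ θ) < C)
    (v : ℝ → EReal) (hv : IsAmbiguityFunction v) (P₀ : ProbabilityMeasure S)
    (hR : ContinuityCondition v P₀ κ 𝔽 Y)
    {n : ℕ} (t : Fin (n + 1) → Icc (0 : ℝ) T) (ht : StrictMono t)
    (ht₀ : 0 < (t 0 : ℝ)) (htT : (t (Fin.last n) : ℝ) = T)
    (hna : ∀ i, IsNonatomicOn P (𝔽 (t i))) :
    ∃ τs ∈ gridStoppingTimes 𝔽 t, ∃ Qs : ProbabilityMeasure S,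
      -- the saddle point
      (∀ τ ∈ gridStoppingTimes 𝔽 t, ∀ Q : ProbabilityMeasure S,
        payoff v P₀ κ Y τ Qs ≤ payoff v P₀ κ Y τs Qs ∧
          payoff v P₀ κ Y τs Qs ≤ payoff v P₀ κ Y τs Q) ∧
      -- the inner minima and maxima are attained
      (∀ τ ∈ gridStoppingTimes 𝔽 t, ∃ Q₁, ∀ Q, payoff v P₀ κ Y τ Q₁ ≤ payoff v P₀ κ Y τ Q) ∧
      (∀ Q, ∃ τ₁ ∈ gridStoppingTimes 𝔽 t, ∀ τ ∈ gridStoppingTimes 𝔽 t,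
        payoff v P₀ κ Y τ Q ≤ payoff v P₀ κ Y τ₁ Q) ∧
      -- the value of the saddle point is the max-min and the min-max
      IsGreatest ((fun τ => ⨅ Q, payoff v P₀ κ Y τ Q) '' gridStoppingTimes 𝔽 t)
        (payoff v P₀ κ Y τs Qs) ∧
      IsLeast (range fun Q => ⨆ τ ∈ gridStoppingTimes 𝔽 t, payoff v P₀ κ Y τ Q)
        (payoff v P₀ κ Y τs Qs) := by
  have hYm : ∀ i, Measurable (Y (t i)) := fun i => hY.measurable
  have hYi : ∀ θ i, Integrable (Y (t i)) (κ θ) := by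
    obtain ⟨C, hC⟩ := hYint
    refine fun θ i => ⟨(hYm i).aestronglyMeasurable, ?_⟩
    -- Monotonicity of the integral asks for no measurability of the supremum over uncountably many
    -- times.
    refine (lintegral_mono fun ω => ?_).trans_lt ((hC θ).trans ENNReal.coe_lt_top)
    rw [← ofReal_norm]
    exact le_iSup (fun s => ENNReal.ofReal |Y s ω|) (t i)
  set K := attainable (fun θ => κ θ) (fun i => 𝔽 (t i)) (fun i => Y (t i))
  obtain ⟨hKc, hK⟩ : IsCompact K ∧ Convex ℝ K :=
    isCompact_convex_attainable (fun i => 𝔽.le _) (fun i j hij => 𝔽.mono (ht.monotone hij)) hκ hna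
      hYm hYi
  have hKne : K.Nonempty := ⟨_, fun _ => 0, fun i => MeasurableSet.const _, fun _ => rfl⟩
  have hKof : ∀ τ ∈ gridStoppingTimes 𝔽 t, (fun θ => ∫ ω, Y (τ ω) ω ∂(κ θ)) ∈ K := by
    intro τ hτ
    obtain ⟨ρ, hρ, rfl⟩ := exists_index_of_mem_gridStoppingTimes ht hτ
    exact ⟨ρ, hρ, fun θ => rfl⟩
  have hofK : ∀ x ∈ K, ∃ τ ∈ gridStoppingTimes 𝔽 t, x = fun θ => ∫ ω, Y (τ ω) ω ∂(κ θ) := by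
    rintro x ⟨ρ, hρ, hx⟩
    exact ⟨_, mem_gridStoppingTimes_of_index hρ, funext hx⟩
  have hpay : ∀ τ ∈ gridStoppingTimes 𝔽 t, ∀ Q : ProbabilityMeasure S, payoff v P₀ κ Y τ Q =
      drapeauKupper v P₀ Q (∫ θ, (fun θ => ∫ ω, Y (τ ω) ω ∂(κ θ)) θ ∂(Q : Measure S)) := by
    intro τ hτ Q
    obtain ⟨ρ, hρ, rfl⟩ := exists_index_of_mem_gridStoppingTimes ht hτ
    have hρ' : ∀ i, MeasurableSet (ρ ⁻¹' {i}) := fun i => 𝔽.le _ _ (hρ i)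
    have hm : Measurable fun ω => Y (t (ρ ω)) ω :=
      (measurable_from_prod_countable_right (f := fun p : Fin (n + 1) × Ω => Y (t p.1) p.2) hYm).comp
        ((measurable_to_countable' hρ').prodMk measurable_id)
    rw [payoff, integral_mixture Q hm fun θ =>
      (integral_stopped_eq_sum (y := fun i => Y (t i)) (hYi θ) hρ').1]
  have hcont : ∀ x ∈ K, ∀ Q : ProbabilityMeasure S,
      ContinuousAt (drapeauKupper v P₀ Q) (∫ θ, x θ ∂(Q : Measure S)) := by
    intro x hx Q
    rcases hR with hR | ⟨hR, hpos⟩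
    · exact (hR Q).continuousAt
    · refine (hR Q).continuousAt (Ioi_mem_nhds ?_)
      obtain ⟨τ, hτ, rfl⟩ := hofK x hx
      rw [integral_eq_sum]
      -- The weights sum to 1, so one of them is positive, and the average of positive expectations
      -- is positive.
      have h0 : ∀ θ, 0 ≤ (Q : Measure S).real {θ} := fun θ => measureReal_nonneg
      obtain ⟨θ, -, hθ⟩ := Finset.exists_ne_zero_of_sum_ne_zero
        ((sum_weights Q).trans_ne one_ne_zero)
      exact Finset.sum_pos' (fun θ _ => mul_nonneg (h0 θ) (hpos τ hτ.1 θ).le)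
        ⟨θ, Finset.mem_univ _, mul_pos ((h0 θ).lt_of_ne' hθ) (hpos τ hτ.1 θ)⟩
  obtain ⟨Qs, x₁, hx₁, hsaddle⟩ := exists_saddlePoint_drapeauKupper hKc hK hKne hcont
  obtain ⟨τs, hτs, rfl⟩ := hofK x₁ hx₁
  -- This one inequality contains both saddle inequalities (take `Q = Qs` or `τ = τs`) and both
  -- minimax identities.
  have hle : ∀ τ ∈ gridStoppingTimes 𝔽 t, ∀ Q, payoff v P₀ κ Y τ Qs ≤ payoff v P₀ κ Y τs Q := by
    intro τ hτ Q
    rw [hpay τ hτ, hpay τs hτs]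
    exact hsaddle Q _ (hKof τ hτ)
  refine ⟨τs, hτs, Qs, fun τ hτ Q => ⟨hle τ hτ Qs, hle τs hτs Q⟩, fun τ hτ => ?_, fun Q => ?_,
    ⟨⟨τs, hτs, ?_⟩, ?_⟩, ⟨⟨Qs, ?_⟩, ?_⟩⟩
  · simp only [hpay τ hτ]
    exact exists_min_drapeauKupper_integral (hcont _ (hKof τ hτ))
  · obtain ⟨x, hx, hmax⟩ := ((upperSemicontinuous_drapeauKupper_integral (v := v) (P₀ := P₀)
      Q).upperSemicontinuousOn K).exists_isMaxOn hKne hKc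
    obtain ⟨τ₁, hτ₁, rfl⟩ := hofK x hx
    refine ⟨τ₁, hτ₁, fun τ hτ => ?_⟩
    rw [hpay τ hτ, hpay τ₁ hτ₁]
    exact hmax (hKof τ hτ)
  · exact le_antisymm (iInf_le _ Qs) (le_iInf fun Q => hle τs hτs Q)
  · rintro _ ⟨τ, hτ, rfl⟩
    exact (iInf_le _ Qs).trans (hle τ hτ Qs)
  · exact le_antisymm (iSup₂_le fun τ hτ => hle τ hτ Qs)
      (le_iSup₂ (f := fun τ (_ : τ ∈ gridStoppingTimes 𝔽 t) => payoff v P₀ κ Y τ Qs) τs hτs)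
  · rintro _ ⟨Q, rfl⟩
    exact (hle τs hτs Q).trans
      (le_iSup₂ (f := fun τ (_ : τ ∈ gridStoppingTimes 𝔽 t) => payoff v P₀ κ Y τ Q) τs hτs)
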